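/- **Setting.** Let $(U,\mathcal F)$ be a set system with finitely many sets $S\in\mathcal F$ of cost $c_S>0$, in which every element lies in at least one set. An instance is a sequence of $T$ updates, each the arrival of an inactive element or the departure of an active one; $A$ denotes the set of active elements, initially empty. Let $f$ be an integer such that every element that arrives lies in at most $f$ sets (for instance, the maximum number of sets containing an element), and put $\beta=32f$. **Levels.** Every set $S$ has an integer $\mathrm{level}(S)$, initially its base level $b(S)=-\lceil\log_2(\beta c_S)\rceil-1$. For an element $e$ let $\mathrm{level}(e)=\max_{S\ni e}\mathrm{level}(S)$ and $y(e)=2^{-\mathrm{level}(e)}$; for a set let $y(S)=\sum_{e\in S\cap A}y(e)$. Call $S$ *stable* if $\mathrm{level}(S)\ge b(S)$, and $y(S)\in[c_S/\beta,\ \beta c_S]$ when $\mathrm{level}(S)>b(S)$, and $y(S)\le\beta c_S$ when $\mathrm{level}(S)=b(S)$. The maintained solution is $\mathcal S=\{S:\mathrm{level}(S)>b(S)\}$. **Algorithm.** The algorithm stores the levels, the dual values, for every set $S$ and every level $l\ge\mathrm{level}(S)$ a doubly linked list of the active elements of $S$ at level $l$, for every active element the list of its nodes in these lists, and a first-in-first-out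 queue of sets. When an element $e$ arrives (given together with the list of the sets containing it) or departs, $y(S)$ and the lists are updated for all $S\ni e$. Whenever $y(S)$ is changed in memory, $S$ is put into the queue if it is not there and $y(S)>\beta c_S$, or $y(S)<c_S/\beta$ and $\mathrm{level}(S)>b(S)$. Then, while the queue is non-empty, its first set $S$ is removed and processed: * if $y(S)>\beta c_S$, the set $S$ moves up, one level at a time, to the lowest level at which $y(S)\le\beta c_S$, where the contributions to $y(S)$ of the elements at level $\mathrm{level}(S)$ and of the other elements are kept as two running sums; then the levels and lists of the elements whose level is now $\mathrm{level}(S)$ and the dual values of all sets containing them are updated; * otherwise, if $y(S)<c_S/\beta$ and $\mathrm{level}(S)>b(S)$, the set $S$ moves down, one level at a time, with all the data updated after each level, until $y(S)\ge c_S/\beta$ or $\mathrm{level}(S)=b(S)$; if no element of $S$ has level $\mathrm{level}(S)$, then $S$ moves to $b(S)$ at once. The update time is the number of elementary steps: reading or writing a cell of memory, accessing a list, inserting or deleting a list node through a pointer, operating on the queue, advancing in the traversal of a list, and passing through a loop each count as one step; between two steps boundedly many arithmetic operations and comparisons are free. The computation of the base levels before the first update is not counted. **Theorem.** There is an absolute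 constant $C$ such that, for every such set system, every such $f$ and every such sequence of $T$ updates (hence after every prefix of it), the algorithm terminates, and at the end 1. the stored levels of the active elements and the stored dual values of the sets are the values $\mathrm{level}(e)$ and $y(S)$ defined above, and every set is stable; 2. $\mathcal S$ is a feasible cover: every active element lies in a set of $\mathcal S$; 3. $\sum_{S\in\mathcal S}c_S\le C f^3\cdot\mathrm{OPT}$, where $\mathrm{OPT}$ is the minimum cost of a subfamily of $\mathcal F$ that covers $A$; 4. the total number of steps is at most $C f^2\,T$, that is, the amortized update time is $O(f^2)$ per arrival or departure. -/

import Mathlib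

namespace DynSetCover

/-! ### Set systems, update sequences, covers -/

/-- A weighted set system: a family of subsets of `U`, indexed by `ι`, with positive costs, in which
every element of `U` lies in at least one set. -/
structure SetSystem (U ι : Type) where
  family : ι → Set U
  cost : ι → ℝ
  cost_pos : ∀ S, 0 < cost S
  covered : ∀ e, ∃ S, e ∈ family S

/-- One update of the dynamic instance. -/
inductive Update (U : Type) where
  | arrive (e : U)
  | depart (e : U)

/-- The set of active elements after an update, when `A` is the set of active elements before it. -/
def Update.apply {U : Type} (A : Set U) : Update U → Set U
  | .arrive e => insert e A
  | .depart e => A \ {e}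

/-- An element arrives only when it is inactive and departs only when it is active. -/
def Update.Legal {U : Type} (A : Set U) : Update U → Prop
  | .arrive e => e ∉ A
  | .depart e => e ∈ A

/-- A sequence of updates is legal from the set `A` of active elements. -/
def LegalFrom {U : Type} : Set U → List (Update U) → Prop
  | _, [] => True
  | A, u :: σ => u.Legal A ∧ LegalFrom (u.apply A) σ

/-- A legal sequence of updates; initially no element is active. -/
def Legal {U : Type} (σ : List (Update U)) : Prop := LegalFrom ∅ σ

/-- The elements that are active after the sequence `σ` of updates. -/
def active {U : Type} (σ : List (Update U)) : Set U := σ.foldl Update.apply ∅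

noncomputable section

open scoped Classical

namespace SetSystem

variable {U ι : Type} [Fintype ι] (I : SetSystem U ι)

/-- The sets that contain `e`. -/
def setsOf (e : U) : Finset ι := Finset.univ.filter fun S => e ∈ I.family S

theorem setsOf_nonempty (e : U) : (I.setsOf e).Nonempty := by
  obtain ⟨S, hS⟩ := I.covered e
  exact ⟨S, by simp [setsOf, hS]⟩

/-- The number of sets that contain `e`. -/
def freq (e : U) : ℕ := (I.setsOf e).card

/-- The subfamily `X` covers all elements of `A`. -/
def Covers (X : Finset ι) (A : Set U) : Prop := ∀ e ∈ A, ∃ S ∈ X, e ∈ I.family S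

/-- The cost of a subfamily. -/
def totalCost (X : Finset ι) : ℝ := ∑ S ∈ X, I.cost S

/-! ### Levels, dual values, stability -/

/-- The parameter `β = 32 f`. -/
def beta (f : ℕ) : ℝ := 32 * f

/-- The base level `b(S) = -⌈log₂ (β c_S)⌉ - 1`. -/
def base (f : ℕ) (S : ι) : ℤ := -⌈Real.logb 2 (beta f * I.cost S)⌉ - 1

/-- The dual value `2 ^ (-l)` that belongs to the level `l`. -/
def dual (l : ℤ) : ℝ := (2 : ℝ) ^ (-l)

/-- The level of an element: the largest level of a set that contains it. -/
def elementLevel (level : ι → ℤ) (e : U) : ℤ := (I.setsOf e).sup' (I.setsOf_nonempty e) level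

/-- The dual value of the set `S`: the sum of `2 ^ (-level e)` over the active elements `e` of `S`.
(In every use the set `A` is finite.) -/
def setDual (level : ι → ℤ) (A : Set U) (S : ι) : ℝ :=
  ∑ᶠ e ∈ I.family S ∩ A, dual (I.elementLevel level e)

/-- Stability of the set `S`: it is at its base level or above; above the base level its dual value
is in `[c_S / β, β c_S]`, and at the base level it is at most `β c_S`. -/
def Stable (f : ℕ) (level : ι → ℤ) (A : Set U) (S : ι) : Prop :=
  I.base f S ≤ level S ∧
  (I.base f S < level S →
    I.setDual level A S ∈ Set.Icc (I.cost S / beta f) (beta f * I.cost S)) ∧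
  (level S = I.base f S → I.setDual level A S ≤ beta f * I.cost S)

/-- The maintained solution: all sets that are strictly above their base levels. -/
def solution (f : ℕ) (level : ι → ℤ) : Finset ι :=
  Finset.univ.filter fun S => I.base f S < level S

end SetSystem

/-! ### The memory of the algorithm and programs with a step count -/

/-- The memory of the algorithm. The doubly linked lists of a set `S` are indexed by levels:
`lists S l` holds the elements of `S` at level `l`, so `lists S (level S)` is `out(S)`, and for
`l > level S` the list `lists S l` is `in_l(S)`. The dual value of an element is recorded through
its exponent `eltLevel`. The list `nodelist e` holds, for every set `S` that contains `e`, the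
pointer to the node of `e` in the lists of `S`. Besides the queue there is one bit
per set that records whether the set is in the queue. -/
structure Store (U ι : Type) where
  level : ι → ℤ
  ySet : ι → ℝ
  eltLevel : U → ℤ
  lists : ι → ℤ → List U
  nodelist : U → List ι
  queue : List ι
  inQueue : ι → Bool

/-- The outcome of a terminating computation: a value, the number of steps, the final memory. -/
structure Outcome (U ι α : Type) where
  val : α
  time : ℕ
  store : Store U ι

/-- A program: a partial function (undefined where the program does not terminate) from the initial
memory to the outcome. -/
structure Prog (U ι α : Type) where
  exec : Store U ι → Part (Outcome U ι α)

/-- The memory before the first update: no element is active, and every set is at its base level. -/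
def emptyStore {U ι : Type} (base : ι → ℤ) : Store U ι where
  level := base
  ySet := fun _ => 0
  eltLevel := fun _ => 0
  lists := fun _ _ => []
  nodelist := fun _ => []
  queue := []
  inQueue := fun _ => false

section Programs

variable {U ι : Type}

/-- Sequential composition adds the numbers of steps. -/
instance : Monad (Prog U ι) where
  pure a := ⟨fun s => Part.some ⟨a, 0, s⟩⟩
  bind p q := ⟨fun s => (p.exec s).bind fun r => ((q r.val).exec r.store).map fun r' =>
    ⟨r'.val, r.time + r'.time, r'.store⟩⟩

/-- A single step. It is used only for the elementary memory operations listed below, each of which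
inspects or changes a bounded number of memory cells (a list being accessed through pointers). -/
def step {α : Type} (g : Store U ι → α × Store U ι) : Prog U ι α :=
  ⟨fun s => Part.some ⟨(g s).1, 1, (g s).2⟩⟩

/-- Traverses a list, in one step per entry plus the steps of the body. -/
def foldEach {α γ : Type} : List α → γ → (γ → α → Prog U ι γ) → Prog U ι γ
  | [], z, _ => pure z
  | x :: xs, z, body => do
      step fun s => ((), s)
      let z' ← body z x
      foldEach xs z' body

/-- Traverses a list, in one step per entry plus the steps of the body. -/
def forEach {α : Type} (xs : List α) (body : α → Prog U ι Unit) : Prog U ι Unit :=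
  foldEach xs () fun _ x => body x

/-- One iteration of a loop, applied to the loop variables, the number of steps so far and the
memory. It takes one step plus the steps of the body. -/
def loopStep {γ α : Type} (body : γ → Prog U ι (α ⊕ γ)) :
    Outcome U ι γ →. Outcome U ι α ⊕ Outcome U ι γ := fun x =>
  ((body x.val).exec x.store).map fun r =>
    match r.val with
    | .inl a => .inl ⟨a, x.time + r.time + 1, r.store⟩
    | .inr z => .inr ⟨z, x.time + r.time + 1, r.store⟩

/-- The loop that executes `body`, with loop variables in `γ`, until it returns a result `Sum.inl a`;
while it returns `Sum.inr z`, the loop continues with the loop variables `z`. If the loop runs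
forever, its value is undefined. -/
def loop {γ α : Type} (body : γ → Prog U ι (α ⊕ γ)) (z : γ) : Prog U ι α :=
  ⟨fun s => PFun.fix (loopStep body) ⟨z, 0, s⟩⟩

/-! The elementary memory operations, of one step each. -/

def readLevel (S : ι) : Prog U ι ℤ := step fun s => (s.level S, s)

def writeLevel (S : ι) (l : ℤ) : Prog U ι Unit := step fun s =>
  ((), { s with level := Function.update s.level S l })

def readY (S : ι) : Prog U ι ℝ := step fun s => (s.ySet S, s)

def addY (S : ι) (x : ℝ) : Prog U ι Unit := step fun s =>
  ((), { s with ySet := Function.update s.ySet S (s.ySet S + x) })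

def readEltLevel (e : U) : Prog U ι ℤ := step fun s => (s.eltLevel e, s)

def writeEltLevel (e : U) (l : ℤ) : Prog U ι Unit := step fun s =>
  ((), { s with eltLevel := Function.update s.eltLevel e l })

/-- Returns (the pointer to) the list of the elements of `S` at level `l`. -/
def readList (S : ι) (l : ℤ) : Prog U ι (List U) := step fun s => (s.lists S l, s)

/-- Inserts the node of `e` at the front of the list of `S` with index `l`. -/
def insertNode (e : U) (S : ι) (l : ℤ) : Prog U ι Unit := step fun s =>
  let row := Function.update (s.lists S) l (e :: s.lists S l)
  ((), { s with lists := Function.update s.lists S row })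

/-- Unlinks the node of `e` from the doubly linked list of `S` with index `l`. -/
def deleteNode (e : U) (S : ι) (l : ℤ) : Prog U ι Unit := step fun s =>
  let row := Function.update (s.lists S) l ((s.lists S l).erase e)
  ((), { s with lists := Function.update s.lists S row })

def readNodelist (e : U) : Prog U ι (List ι) := step fun s => (s.nodelist e, s)

/-- Adds (the pointer to) the node of `e` in the lists of `S` to the nodelist of `e`. -/
def pushNodelist (e : U) (S : ι) : Prog U ι Unit := step fun s =>
  ((), { s with nodelist := Function.update s.nodelist e (S :: s.nodelist e) })

/-- Removes the first entry of the nodelist of `e`. -/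
def popNodelist (e : U) : Prog U ι Unit := step fun s =>
  ((), { s with nodelist := Function.update s.nodelist e (s.nodelist e).tail })

def readInQueue (S : ι) : Prog U ι Bool := step fun s => (s.inQueue S, s)

/-- Appends `S` to the end of the queue. -/
def enqueue (S : ι) : Prog U ι Unit := step fun s =>
  ((), { s with queue := s.queue ++ [S], inQueue := Function.update s.inQueue S true })

/-- Removes and returns the first set of the queue, if there is one. -/
def dequeue : Prog U ι (Option ι) := step fun s =>
  match s.queue with
  | [] => (none, s)
  | S :: Q => (some S, { s with queue := Q, inQueue := Function.update s.inQueue S false })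

/-! ### The algorithm

Between two memory operations only boundedly many operations on integers, reals and Booleans take
place: arithmetic, comparisons, and the evaluation of `2 ^ (-l)` and of the precomputed base levels. -/

open SetSystem

variable [Fintype ι] (I : SetSystem U ι) (f : ℕ)

/-- Adds `S` to the queue if it violates stability and is not in the queue yet. -/
def enqueueIfUnstable (S : ι) : Prog U ι Unit := do
  let y ← readY S
  let l ← readLevel S
  let q ← readInQueue S
  if (beta f * I.cost S < y ∨ (y < I.cost S / beta f ∧ I.base f S < l)) ∧ q = false then
    enqueue S

/-- The dual value of `e` changes from `2 ^ (-lOld)` to `2 ^ (-lNew)`: moves the nodes of `e` to the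
correct lists, updates the dual values of the sets that contain `e`, and queues unstable ones. -/
def updateDual (e : U) (lOld lNew : ℤ) : Prog U ι Unit := do
  let nodes ← readNodelist e
  forEach nodes fun S => do
    if lOld ≠ lNew then
      deleteNode e S lOld
      insertNode e S lNew
    addY S (dual lNew - dual lOld)
    enqueueIfUnstable I f S

/-- One iteration of the inner loop of an upward move, with loop variables: the current level of `S`,
the contribution `yOut` of `out(S)`, the contribution `yIn` of the other elements of `S`, and
`out(S)`. It moves `S` up by one level, and ends the loop when the dual value is at most `β c_S`. -/
def upStep (S : ι) (z : ℤ × ℝ × ℝ × List U) :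
    Prog U ι ((ℤ × List U) ⊕ (ℤ × ℝ × ℝ × List U)) := do
  let (l, yOut, yIn, out) := z
  let l' := l + 1
  writeLevel S l'
  let inl ← readList S l'
  let (k, out') ← foldEach inl ((0 : ℕ), out) fun a e => pure (a.1 + 1, e :: a.2)
  let yOut' := yOut / 2 + dual l' * k
  let yIn' := yIn - dual l' * k
  if yOut' + yIn' ≤ beta f * I.cost S then
    pure (.inl (l', out'))
  else
    pure (.inr (l', yOut', yIn', out'))

/-- Moves `S` up, level by level, to the lowest level at which its dual value is at most `β c_S`, and
then updates the elements whose level is now the level of `S`. -/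
def moveUp (S : ι) : Prog U ι Unit := do
  let l ← readLevel S
  let y ← readY S
  let out ← readList S l
  let yOut ← foldEach out (0 : ℝ) fun a e => do
    let k ← readEltLevel e
    pure (a + dual k)
  let (l', out') ← loop (upStep I f S) (l, yOut, y - yOut, out)
  forEach out' fun e => do
    let k ← readEltLevel e
    writeEltLevel e l'
    updateDual I f e k l'

/-- One iteration of a downward move of `S`: if `out(S)` is empty, `S` moves to its base level at
once; otherwise it moves down by one level. The loop ends when `S` is at its base level or
`y(S) ≥ c_S / β`. -/
def downStep (S : ι) : Prog U ι (Unit ⊕ Unit) := do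
  let l ← readLevel S
  let out ← readList S l
  if out = [] then
    writeLevel S (I.base f S)
    pure (.inl ())
  else
    writeLevel S (l - 1)
    forEach out fun e => do
      let nodes ← readNodelist e
      let higher ← foldEach nodes false fun a S' => do
        let k ← readLevel S'
        pure (a || decide (l ≤ k))
      if higher = false then
        writeEltLevel e (l - 1)
        updateDual I f e l (l - 1)
    let y ← readY S
    if y < I.cost S / beta f ∧ I.base f S < l - 1 then
      pure (.inr ())
    else
      pure (.inl ())

/-- Moves `S` down. -/
def moveDown (S : ι) : Prog U ι Unit := loop (fun _ => downStep I f S) ()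

/-- Takes a set from the queue, if there is one, and moves it up or down if it is unstable. -/
def stabilizeStep : Prog U ι (Unit ⊕ Unit) := do
  match ← dequeue with
  | none => pure (.inl ())
  | some S =>
      let y ← readY S
      let l ← readLevel S
      if beta f * I.cost S < y then
        moveUp I f S
      else if y < I.cost S / beta f ∧ I.base f S < l then
        moveDown I f S
      pure (.inr ())

/-- Repeats `stabilizeStep` until the queue is empty. -/
def stabilize : Prog U ι Unit := loop (fun _ => stabilizeStep I f) ()

/-- The arrival of `e`, which is presented with the list of the sets that contain it. -/
def arrival (e : U) : Prog U ι Unit := do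
  match (I.setsOf e).toList with
  | [] => pure ()
  | S₀ :: rest =>
      let l₀ ← readLevel S₀
      let l ← foldEach rest l₀ fun a S => do
        let k ← readLevel S
        pure (max a k)
      writeEltLevel e l
      forEach (S₀ :: rest) fun S => do
        addY S (dual l)
        insertNode e S l
        pushNodelist e S
        enqueueIfUnstable I f S
  stabilize I f

/-- The departure of `e`. -/
def departure (e : U) : Prog U ι Unit := do
  let l ← readEltLevel e
  let nodes ← readNodelist e
  forEach nodes fun S => do
    addY S (-dual l)
    deleteNode e S l
    popNodelist e
    enqueueIfUnstable I f S
  stabilize I f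

/-- The processing of one update. -/
def process : Update U → Prog U ι Unit
  | .arrive e => arrival I f e
  | .depart e => departure I f e

/-- The processing of a sequence of updates, one after the other. -/
def processAll : List (Update U) → Prog U ι Unit
  | [] => pure ()
  | u :: σ => do
      process I f u
      processAll σ

/-- The run of the algorithm with parameter `f` on the sequence `σ` of updates. -/
def run (σ : List (Update U)) : Part (Outcome U ι Unit) :=
  (processAll I f σ).exec (emptyStore (I.base f))

end Programs

end

end DynSetCover

/-! Correctness and cost are separate arguments.

Cover. Write M = β c_S. The base level is normalised so that 2^b(S) M lies in (1/4, 1/2]. If every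
set of maximal level around an active element e were at its base level, then y(e) = 2^(-b(S)) alone
would exceed M for such a set S, against stability; so the solution is feasible
(`Consistent.covers`). The cost bound is approximate linear programming duality: c_S ≤ β y(S) on the
solution, each y(e) is counted at most f times, and y(S) ≤ β c_S bounds the total of the y(e) by β
times the cost of any cover. This gives the factor β · f · β = 1024 f³ (`Consistent.totalCost_le`).

Time. Programs are handled by a total-correctness calculus `wp` in which the step count is part of
the postcondition. Every piece of the algorithm is shown to keep `Consistent`, and steps are paid
from `potential`, a sum over all sets plus 10 per queue entry.

For upward moves let φ(j) = ∑ min(1, 2^(j - v(e))) over the active elements of S with levels v; this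
is `scaledDual`. If S moved to a level j at or above its own, φ(j) would be 2^j y(S), and the
algorithm moves S up while φ(j) > 2^j M. The recurrence φ(j+1) = 2 φ(j) - N(j), with N(j) the number
of elements of level at most j, ties the growth of φ to the number of elements that a move must
touch. `upPotential` is the positive part of the supremum of (φ(i) - 2^i M) + 20 (φ(j) - 2^j M / 2)
- (l - b) over i > l and j ≥ l. The first summand pays N(l') for a move to l' through the
recurrence, the term l - b pays for the levels passed, and the second summand guarantees that enough
was saved when the potential drops to 0. A rise of other levels never increases it, and one new or
lowered element increases it by at most 21.

For downward moves `downPotential` is 128 · 2^l · max(0, M/4 - y(S)) above the base level. One step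
down halves 2^l and so releases at least 15 · 2^l M. Since y(S) < c_S / β = M / (1024 f²), at most
2^l M / (1024 f²) elements have the level of S, and the release pays for the steps and for the
increase of the up-potentials of all sets, which is of order f² per lowered element. An upward move
leaves y(S) > M/2 and a downward step leaves y(S) ≤ M/512, so after a move in one direction the
potential of S for the other direction is 0.

An arrival adds O(f) to the up-part at each of at most f sets, and a departure adds O(1) to the
down-part at each of at most f sets. Together with the direct work this is O(f²) per update. -/

namespace DynSetCover

noncomputable section

open scoped Classical
open SetSystem

section

variable {U ι : Type}

/-! ### Weakest preconditions of programs -/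

/-- The program `p` terminates from the memory `s`, and its value, its number of steps and the final
memory satisfy `Q`. -/
def wp {α : Type} (p : Prog U ι α) (s : Store U ι) (Q : α → ℕ → Store U ι → Prop) : Prop :=
  ∃ r ∈ p.exec s, Q r.val r.time r.store

theorem wp_mono {α : Type} {p : Prog U ι α} {s : Store U ι} {Q R : α → ℕ → Store U ι → Prop}
    (h : wp p s Q) (hQR : ∀ a t s', Q a t s' → R a t s') : wp p s R := by
  obtain ⟨r, hr, hQ⟩ := h
  exact ⟨r, hr, hQR _ _ _ hQ⟩

theorem wp_pure {α : Type} {a : α} {s : Store U ι} {Q : α → ℕ → Store U ι → Prop} :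
    wp (pure a : Prog U ι α) s Q ↔ Q a 0 s := by
  constructor
  · rintro ⟨r, hr, hQ⟩
    obtain rfl := Part.mem_some_iff.1 hr
    exact hQ
  · intro h
    exact ⟨⟨a, 0, s⟩, Part.mem_some _, h⟩

theorem wp_bind {α γ : Type} {p : Prog U ι α} {q : α → Prog U ι γ} {s : Store U ι}
    {Q : γ → ℕ → Store U ι → Prop} :
    wp (p >>= q) s Q ↔ wp p s fun a t s' => wp (q a) s' fun b t' s'' => Q b (t + t') s'' := by
  constructor
  · rintro ⟨r, hr, hQ⟩
    obtain ⟨r₁, h₁, h₂⟩ := Part.mem_bind_iff.1 hr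
    obtain ⟨r₂, h₃, rfl⟩ := (Part.mem_map_iff _).1 h₂
    exact ⟨r₁, h₁, r₂, h₃, hQ⟩
  · rintro ⟨r₁, h₁, r₂, h₂, hQ⟩
    exact ⟨⟨r₂.val, r₁.time + r₂.time, r₂.store⟩,
      Part.mem_bind_iff.2 ⟨r₁, h₁, (Part.mem_map_iff _).2 ⟨r₂, h₂, rfl⟩⟩, hQ⟩

theorem wp_step {α : Type} {g : Store U ι → α × Store U ι} {s : Store U ι}
    {Q : α → ℕ → Store U ι → Prop} : wp (step g) s Q ↔ Q (g s).1 1 (g s).2 := by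
  constructor
  · rintro ⟨r, hr, hQ⟩
    obtain rfl := Part.mem_some_iff.1 hr
    exact hQ
  · intro h
    exact ⟨_, Part.mem_some _, h⟩

theorem wp_ite {α : Type} {c : Prop} [Decidable c] {p q : Prog U ι α} {s : Store U ι}
    {Q : α → ℕ → Store U ι → Prop} :
    wp (if c then p else q) s Q ↔ (c → wp p s Q) ∧ (¬ c → wp q s Q) := by
  split_ifs with h <;> simp [h]

/-- The rule for traversals of lists: the invariant refers to the entries that remain. -/
theorem wp_foldEach {α γ : Type} {body : γ → α → Prog U ι γ}
    (Inv : List α → γ → ℕ → Store U ι → Prop) {xs : List α} {z : γ} {s : Store U ι}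
    (h0 : Inv xs z 0 s)
    (hstep : ∀ x rest z t s, Inv (x :: rest) z t s →
      wp (body z x) s fun z' t' s' => Inv rest z' (t + 1 + t') s') :
    wp (foldEach xs z body) s (Inv []) := by
  suffices H : ∀ (xs : List α) z t s, Inv xs z t s →
      wp (foldEach xs z body) s fun z' t' s' => Inv [] z' (t + t') s' by
    simpa using H xs z 0 s h0
  intro xs
  induction xs with
  | nil => intro z t s h; simpa [foldEach, wp_pure] using h
  | cons x xs ih =>
    intro z t s h
    simp only [foldEach, wp_bind, wp_step]
    refine wp_mono (hstep x xs z t s h) fun z' t' s' h' => ?_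
    refine wp_mono (ih _ _ _ h') fun z'' t'' s'' h'' => ?_
    convert h'' using 1
    ring

theorem wp_forEach {α : Type} {body : α → Prog U ι Unit}
    (Inv : List α → ℕ → Store U ι → Prop) {xs : List α} {s : Store U ι}
    (h0 : Inv xs 0 s)
    (hstep : ∀ x rest t s, Inv (x :: rest) t s →
      wp (body x) s fun _ t' s' => Inv rest (t + 1 + t') s') :
    wp (forEach xs body) s fun _ t s' => Inv [] t s' :=
  wp_foldEach (fun xs _ t s => Inv xs t s) h0 fun x rest _ t s h => hstep x rest t s h

/-- The rule for loops, with a variant `n` that decreases in every iteration. -/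
theorem wp_loop {α γ : Type} {body : γ → Prog U ι (α ⊕ γ)}
    (Inv : ℕ → γ → ℕ → Store U ι → Prop) {Q : α → ℕ → Store U ι → Prop}
    {n : ℕ} {z : γ} {s : Store U ι} (h0 : Inv n z 0 s)
    (hstep : ∀ n z t s, Inv n z t s → wp (body z) s fun r t' s' =>
      (∀ a, r = .inl a → Q a (t + t' + 1) s') ∧
      (∀ z', r = .inr z' → ∃ n' < n, Inv n' z' (t + t' + 1) s')) :
    wp (loop body z) s Q := by
  -- `loopStep` carries the accumulated time inside the outcome, so the induction must allow an
  -- arbitrary starting time.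
  suffices H : ∀ n z t s, Inv n z t s →
      ∃ r ∈ PFun.fix (loopStep body) ⟨z, t, s⟩, Q r.val r.time r.store from H n z 0 s h0
  intro n
  induction n using Nat.strong_induction_on with
  | _ n ih =>
    intro z t s h
    obtain ⟨r, hr, hl, hi⟩ := hstep n z t s h
    rcases hv : r.val with a | z'
    · refine ⟨⟨a, t + r.time + 1, r.store⟩, ?_, hl a hv⟩
      rw [PFun.mem_fix_iff]
      left
      exact (Part.mem_map_iff _).2 ⟨r, hr, by simp [hv]⟩
    · obtain ⟨n', hn', hI⟩ := hi z' hv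
      obtain ⟨r', hr', hQ⟩ := ih n' hn' _ _ _ hI
      refine ⟨r', ?_, hQ⟩
      rw [PFun.mem_fix_iff]
      right
      exact ⟨_, (Part.mem_map_iff _).2 ⟨r, hr, by simp [hv]⟩, hr'⟩

/-! ### Rules for the elementary memory operations. -/

section Primitives

variable {s : Store U ι} {S : ι} {e : U} {l : ℤ}

theorem wp_readLevel {Q : ℤ → ℕ → Store U ι → Prop} :
    wp (readLevel S) s Q ↔ Q (s.level S) 1 s := wp_step

theorem wp_writeLevel {Q : Unit → ℕ → Store U ι → Prop} :
    wp (writeLevel S l) s Q ↔ Q () 1 { s with level := Function.update s.level S l } := wp_step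

theorem wp_readY {Q : ℝ → ℕ → Store U ι → Prop} :
    wp (readY S) s Q ↔ Q (s.ySet S) 1 s := wp_step

theorem wp_addY {x : ℝ} {Q : Unit → ℕ → Store U ι → Prop} :
    wp (addY S x) s Q ↔ Q () 1 { s with ySet := Function.update s.ySet S (s.ySet S + x) } := wp_step

theorem wp_readEltLevel {Q : ℤ → ℕ → Store U ι → Prop} :
    wp (readEltLevel e) s Q ↔ Q (s.eltLevel e) 1 s := wp_step

theorem wp_writeEltLevel {Q : Unit → ℕ → Store U ι → Prop} :
    wp (writeEltLevel e l) s Q ↔ Q () 1 { s with eltLevel := Function.update s.eltLevel e l } :=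
  wp_step

theorem wp_readList {Q : List U → ℕ → Store U ι → Prop} :
    wp (readList S l) s Q ↔ Q (s.lists S l) 1 s := wp_step

theorem wp_insertNode {Q : Unit → ℕ → Store U ι → Prop} :
    wp (insertNode e S l) s Q ↔ Q () 1 { s with
      lists := Function.update s.lists S <| Function.update (s.lists S) l (e :: s.lists S l) } := wp_step

theorem wp_deleteNode {Q : Unit → ℕ → Store U ι → Prop} :
    wp (deleteNode e S l) s Q ↔ Q () 1 { s with
      lists := Function.update s.lists S <| Function.update (s.lists S) l ((s.lists S l).erase e) } := wp_step

theorem wp_readNodelist {Q : List ι → ℕ → Store U ι → Prop} :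
    wp (readNodelist e) s Q ↔ Q (s.nodelist e) 1 s := wp_step

theorem wp_pushNodelist {Q : Unit → ℕ → Store U ι → Prop} :
    wp (pushNodelist e S) s Q ↔
      Q () 1 { s with nodelist := Function.update s.nodelist e (S :: s.nodelist e) } := wp_step

theorem wp_popNodelist {Q : Unit → ℕ → Store U ι → Prop} :
    wp (popNodelist e) s Q ↔
      Q () 1 { s with nodelist := Function.update s.nodelist e (s.nodelist e).tail } := wp_step

theorem wp_readInQueue {Q : Bool → ℕ → Store U ι → Prop} :
    wp (readInQueue S) s Q ↔ Q (s.inQueue S) 1 s := wp_step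

theorem wp_enqueue {Q : Unit → ℕ → Store U ι → Prop} :
    wp (enqueue S) s Q ↔ Q () 1 { s with
      queue := s.queue ++ [S], inQueue := Function.update s.inQueue S true } := wp_step

end Primitives

end

section

variable {U ι : Type}

/-! ### Well-formed memories -/

/-- The elements of `A` that lie in the set `S`. -/
def SetSystem.elems (I : SetSystem U ι) (A : Finset U) (S : ι) : Finset U :=
  A.filter fun e => e ∈ I.family S

variable {I : SetSystem U ι} {f : ℕ} {A : Finset U} {X : Set ι} {s : Store U ι} {S : ι} {e : U}
  {v v' : U → ℤ}

theorem SetSystem.mem_elems : e ∈ I.elems A S ↔ e ∈ A ∧ e ∈ I.family S := by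
  simp [SetSystem.elems]

theorem SetSystem.elems_insert_of_mem (h : e ∈ I.family S) :
    I.elems (insert e A) S = insert e (I.elems A S) := by
  simp [SetSystem.elems, Finset.filter_insert, h]

theorem SetSystem.elems_insert_of_notMem (h : e ∉ I.family S) :
    I.elems (insert e A) S = I.elems A S := by
  simp [SetSystem.elems, Finset.filter_insert, h]

theorem SetSystem.elems_erase : I.elems (A.erase e) S = (I.elems A S).erase e := by
  simp [SetSystem.elems, Finset.filter_erase]

/-- The recorded dual value and level of `S` violate the stability of `S`. -/
def Unstable (I : SetSystem U ι) (f : ℕ) (s : Store U ι) (S : ι) : Prop :=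
  beta f * I.cost S < s.ySet S ∨ (s.ySet S < I.cost S / beta f ∧ I.base f S < s.level S)

/-- The queue contains all unstable sets, except possibly those in `X`. -/
structure QueueOK (I : SetSystem U ι) (f : ℕ) (X : Set ι) (s : Store U ι) : Prop where
  mem_queue : ∀ S, s.inQueue S = true → S ∈ s.queue
  inQueue : ∀ S, S ∉ X → Unstable I f s S → s.inQueue S = true

/-- The lists and the dual value of `S` are correct for the active elements `A` with levels `v`. -/
structure DataFor (I : SetSystem U ι) (A : Finset U) (v : U → ℤ) (s : Store U ι) (S : ι) :
    Prop where
  nodup : ∀ k, (s.lists S k).Nodup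
  mem_lists : ∀ k e, e ∈ s.lists S k ↔ e ∈ I.elems A S ∧ v e = k
  dual_eq : s.ySet S = ∑ e ∈ I.elems A S, dual (v e)

/-- All data are correct for the active elements `A` and the recorded levels of the elements, and the
queue contains all unstable sets that are not in `X`. -/
structure Wf (I : SetSystem U ι) (f : ℕ) (A : Finset U) (X : Set ι) (s : Store U ι) : Prop where
  data : ∀ S, DataFor I A s.eltLevel s S
  nodup_nodelist : ∀ e ∈ A, (s.nodelist e).Nodup
  mem_nodelist : ∀ e ∈ A, ∀ S, S ∈ s.nodelist e ↔ e ∈ I.family S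
  nodelist_nil : ∀ e ∉ A, s.nodelist e = []
  queue : QueueOK I f X s

theorem QueueOK.of_agree {s' : Store U ι} {Y : Set ι} (h : QueueOK I f X s) (hXY : X ⊆ Y)
    (hq : s'.queue = s.queue) (hb : s'.inQueue = s.inQueue)
    (hy : ∀ S ∉ Y, s'.ySet S = s.ySet S) (hl : ∀ S ∉ Y, s'.level S = s.level S) :
    QueueOK I f Y s' := by
  refine ⟨fun S hS => ?_, fun S hS hu => ?_⟩
  · rw [hq]; exact h.mem_queue S (by rwa [← hb])
  · rw [hb]
    refine h.inQueue S (fun hX => hS (hXY hX)) ?_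
    simpa only [Unstable, hy S hS, hl S hS] using hu

theorem DataFor.of_agree {s' : Store U ι} (h : DataFor I A v s S)
    (hl : s'.lists S = s.lists S) (hy : s'.ySet S = s.ySet S)
    (hv : ∀ e ∈ I.elems A S, v' e = v e) : DataFor I A v' s' S := by
  refine ⟨fun k => by rw [hl]; exact h.nodup k, fun k e => ?_, ?_⟩
  · rw [hl, h.mem_lists]
    constructor
    · rintro ⟨he, rfl⟩; exact ⟨he, hv e he⟩
    · rintro ⟨he, rfl⟩; exact ⟨he, (hv e he).symm⟩
  · rw [hy, h.dual_eq]
    exact Finset.sum_congr rfl fun e he => by rw [hv e he]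

/-- The data of a single set after a change of the level of one of its elements. -/
theorem DataFor.update_level {s' : Store U ι} {l : ℤ} (h : DataFor I A v s S)
    (he : e ∈ I.elems A S)
    (hl : s'.lists S = if v e ≠ l then
      Function.update (Function.update (s.lists S) (v e) ((s.lists S (v e)).erase e)) l
        (e :: s.lists S l) else s.lists S)
    (hy : s'.ySet S = s.ySet S + (dual l - dual (v e))) :
    DataFor I A (Function.update v e l) s' S := by
  have hne : ∀ k, k ≠ v e → e ∉ s.lists S k := fun k hk hm => hk ((h.mem_lists k e).1 hm).2.symm
  refine ⟨fun k => ?_, fun k a => ?_, ?_⟩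
  · rw [hl]
    split_ifs with hvl
    · rcases eq_or_ne k l with rfl | hk
      · simpa using ⟨hne _ (Ne.symm hvl), h.nodup _⟩
      · rw [Function.update_of_ne hk]
        rcases eq_or_ne k (v e) with rfl | hk'
        · rw [Function.update_self]; exact (h.nodup _).erase _
        · rw [Function.update_of_ne hk']; exact h.nodup _
    · exact h.nodup k
  · rw [hl]
    split_ifs with hvl
    · rcases eq_or_ne a e with rfl | ha
      · rw [Function.update_self]
        rcases eq_or_ne k l with rfl | hk
        · simp [he]
        · rw [Function.update_of_ne hk]
          rcases eq_or_ne k (v a) with rfl | hk'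
          · simp [(h.nodup _).mem_erase_iff, Ne.symm hk]
          · simp [Function.update_of_ne hk', hne k hk', Ne.symm hk]
      · rw [Function.update_of_ne ha]
        rcases eq_or_ne k l with rfl | hk
        · simp [ha, h.mem_lists]
        · rw [Function.update_of_ne hk]
          rcases eq_or_ne k (v e) with rfl | hk'
          · rw [Function.update_self, (h.nodup _).mem_erase_iff, h.mem_lists]
            simp [ha]
          · rw [Function.update_of_ne hk', h.mem_lists]
    · push Not at hvl
      rw [← hvl, Function.update_eq_self]
      exact h.mem_lists k a
  · rw [hy, h.dual_eq, ← Finset.add_sum_erase _ _ he, ← Finset.add_sum_erase _ _ he,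
      Function.update_self]
    have : ∀ a ∈ (I.elems A S).erase e, dual (Function.update v e l a) = dual (v a) := fun a ha => by
      rw [Function.update_of_ne (Finset.ne_of_mem_erase ha)]
    rw [Finset.sum_congr rfl this]
    ring

/-- The data of a single set after the insertion of an element. -/
theorem DataFor.insert {s' : Store U ι} (h : DataFor I A v s S) (he : e ∈ I.family S) (heA : e ∉ A)
    (hl : s'.lists S = Function.update (s.lists S) (v e) (e :: s.lists S (v e)))
    (hy : s'.ySet S = s.ySet S + dual (v e)) :
    DataFor I (insert e A) v s' S := by
  have heS : e ∉ I.elems A S := fun h => heA (mem_elems.1 h).1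
  refine ⟨fun k => ?_, fun k a => ?_, ?_⟩
  · rw [hl]
    rcases eq_or_ne k (v e) with rfl | hk
    · rw [Function.update_self, List.nodup_cons, h.mem_lists]
      exact ⟨fun h => heS h.1, h.nodup _⟩
    · rw [Function.update_of_ne hk]; exact h.nodup k
  · rw [hl, elems_insert_of_mem he, Finset.mem_insert]
    rcases eq_or_ne k (v e) with rfl | hk
    · rw [Function.update_self, List.mem_cons, h.mem_lists]
      constructor
      · rintro (rfl | h); exacts [⟨.inl rfl, rfl⟩, ⟨.inr h.1, h.2⟩]
      · rintro ⟨rfl | h, h'⟩; exacts [.inl rfl, .inr ⟨h, h'⟩]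
    · rw [Function.update_of_ne hk, h.mem_lists]
      constructor
      · rintro ⟨h, h'⟩; exact ⟨.inr h, h'⟩
      · rintro ⟨rfl | h, h'⟩; exacts [absurd h'.symm hk, ⟨h, h'⟩]
  · rw [hy, h.dual_eq, elems_insert_of_mem he, Finset.sum_insert heS, add_comm]

/-- The data of a single set after the deletion of an element. -/
theorem DataFor.erase {s' : Store U ι} (h : DataFor I A v s S) (he : e ∈ I.elems A S)
    (hl : s'.lists S = Function.update (s.lists S) (v e) ((s.lists S (v e)).erase e))
    (hy : s'.ySet S = s.ySet S + -dual (v e)) :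
    DataFor I (A.erase e) v s' S := by
  refine ⟨fun k => ?_, fun k a => ?_, ?_⟩
  · rw [hl]
    rcases eq_or_ne k (v e) with rfl | hk
    · rw [Function.update_self]; exact (h.nodup _).erase _
    · rw [Function.update_of_ne hk]; exact h.nodup k
  · rw [hl, elems_erase, Finset.mem_erase]
    rcases eq_or_ne k (v e) with rfl | hk
    · rw [Function.update_self, (h.nodup _).mem_erase_iff, h.mem_lists, and_assoc]
    · rw [Function.update_of_ne hk, h.mem_lists]
      constructor
      · rintro ⟨h, rfl⟩; exact ⟨⟨fun h => hk (by rw [h]), h⟩, rfl⟩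
      · rintro ⟨⟨_, h⟩, h'⟩; exact ⟨h, h'⟩
  · rw [hy, h.dual_eq, elems_erase, ← Finset.add_sum_erase _ _ he]
    ring

/-- The test removes `S` from the exempt sets: afterwards it is stable or queued. The four steps are
three reads and possibly one enqueueing. -/
theorem wp_enqueueIfUnstable (h : QueueOK I f (insert S X) s) :
    wp (enqueueIfUnstable I f S) s fun _ t s' => t ≤ 4 ∧ ∃ q b,
      s' = { s with queue := q, inQueue := b } ∧ q.length ≤ s.queue.length + 1 ∧
        QueueOK I f X s' := by
  simp only [enqueueIfUnstable, wp_bind, wp_readY, wp_readLevel, wp_readInQueue, wp_ite, wp_enqueue,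
    wp_pure]
  refine ⟨fun hu => ⟨le_rfl, _, _, rfl, by simp, ?_, ?_⟩,
    fun hu => ⟨by norm_num, _, _, rfl, by simp, ?_, ?_⟩⟩
  · intro S' hS'
    rcases eq_or_ne S' S with rfl | hne
    · simp
    · simp only [Function.update_of_ne hne] at hS'
      simp [h.mem_queue S' hS']
  · intro S' hS' hu'
    rcases eq_or_ne S' S with rfl | hne
    · simp
    · simp only [Function.update_of_ne hne]
      exact h.inQueue S' (by simp [hne, hS']) hu'
  · exact h.mem_queue
  · intro S' hS' hu'
    rcases eq_or_ne S' S with rfl | hne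
    · by_contra hb
      exact hu ⟨hu', by simpa using hb⟩
    · exact h.inQueue S' (by simp [hne, hS']) hu'

variable [Fintype ι]

theorem Wf.length_nodelist (h : Wf I f A X s) (he : e ∈ A) : (s.nodelist e).length = I.freq e := by
  rw [← List.toFinset_card_of_nodup (h.nodup_nodelist e he), freq]
  congr 1
  ext S
  simp [h.mem_nodelist e he, setsOf]

end

section

variable {U ι : Type}

variable {I : SetSystem U ι} {f : ℕ} {A : Finset U} {X : Set ι} {s : Store U ι} {S : ι} {e : U}
  {v v' : U → ℤ}

/-! ### The changes of the data in one update of an element -/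

/-- A write to one dual value can spoil the queue invariant only at that set, which is exempted
until `enqueueIfUnstable` has tested it. -/
theorem QueueOK.of_ySet_update {s' : Store U ι} (h : QueueOK I f X s)
    (hq : s'.queue = s.queue) (hb : s'.inQueue = s.inQueue)
    (hy : ∀ S' ≠ S, s'.ySet S' = s.ySet S') (hl : s'.level = s.level) :
    QueueOK I f (insert S X) s' :=
  h.of_agree (Set.subset_insert _ _) hq hb
    (fun S' hS' => hy S' fun h => hS' (h ▸ Set.mem_insert _ _)) fun S' _ => by rw [hl]

/-- The program is the loop body of `updateDual` as the `do` notation elaborates it, with the code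
after the conditional copied into both branches. -/
theorem wp_updateNode {k l : ℤ} (hqueue : QueueOK I f X s) :
    wp (if k ≠ l then do
          deleteNode e S k
          insertNode e S l
          addY S (dual l - dual k)
          enqueueIfUnstable I f S
        else do
          addY S (dual l - dual k)
          enqueueIfUnstable I f S) s fun _ t s' =>
      t ≤ 7 ∧ s'.level = s.level ∧ s'.eltLevel = s.eltLevel ∧ s'.nodelist = s.nodelist ∧
        s'.ySet = Function.update s.ySet S (s.ySet S + (dual l - dual k)) ∧
        s'.lists = Function.update s.lists S (if k ≠ l then Function.update
          (Function.update (s.lists S) k ((s.lists S k).erase e)) l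
            (e :: s.lists S l) else s.lists S) ∧
        s'.queue.length ≤ s.queue.length + 1 ∧ QueueOK I f X s' := by
  simp only [wp_ite, wp_bind, wp_deleteNode, wp_insertNode, wp_addY]
  refine ⟨fun hkl => ?_, fun hkl => ?_⟩
  · refine wp_mono (wp_enqueueIfUnstable (X := X) (hqueue.of_ySet_update rfl rfl
      (fun S' hS' => Function.update_of_ne hS' _ _) rfl)) ?_
    rintro _ t' s'' ⟨ht', q, b, rfl, hq', hqueue'⟩
    refine ⟨by omega, rfl, rfl, rfl, rfl, ?_, hq', hqueue'⟩
    simp [hkl, Function.update_of_ne (Ne.symm hkl)]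
  · refine wp_mono (wp_enqueueIfUnstable (X := X) (hqueue.of_ySet_update rfl rfl
      (fun S' hS' => Function.update_of_ne hS' _ _) rfl)) ?_
    rintro _ t' s'' ⟨ht', q, b, rfl, hq', hqueue'⟩
    refine ⟨by omega, rfl, rfl, rfl, rfl, ?_, hq', hqueue'⟩
    simp [hkl]

/-- The level of `e` has been changed to `l`; then `updateDual` restores all data. -/
theorem wp_updateDual [Fintype ι] {l : ℤ} (h : Wf I f A X s) (he : e ∈ A) (hf : I.freq e ≤ f) :
    wp (updateDual I f e (s.eltLevel e) l)
      { s with eltLevel := Function.update s.eltLevel e l } fun _ t s' =>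
      t ≤ 1 + 8 * f ∧ Wf I f A X s' ∧ s'.level = s.level ∧
        s'.eltLevel = Function.update s.eltLevel e l ∧ s'.queue.length ≤ s.queue.length + f := by
  have hlen := h.length_nodelist he
  set v := s.eltLevel with hv
  set v' := Function.update v e l with hv'
  simp only [updateDual, wp_bind, wp_readNodelist]
  -- The recorded level of `e` is already new while the lists are repaired one set at a time: sets
  -- still in `rest` have correct data for the old levels `v`, all others for `v'`. Each set costs
  -- one traversal step and at most seven steps in the body.
  refine wp_mono (wp_forEach (fun rest t s' => t + 8 * rest.length ≤ 8 * I.freq e ∧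
    s'.queue.length + rest.length ≤ s.queue.length + I.freq e ∧ rest.Nodup ∧
    (∀ S ∈ rest, e ∈ I.family S) ∧ s'.level = s.level ∧ s'.eltLevel = v' ∧
    s'.nodelist = s.nodelist ∧ (∀ S, DataFor I A (if S ∈ rest then v else v') s' S) ∧
    QueueOK I f X s') ?_ ?_) ?_
  · refine ⟨by omega, by simp [hlen], h.nodup_nodelist e he, fun S => (h.mem_nodelist e he S).1,
      rfl, rfl, rfl, fun S => ?_, h.queue.of_agree subset_rfl rfl rfl (fun _ _ => rfl)
        fun _ _ => rfl⟩
    split_ifs with hS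
    · exact (h.data S).of_agree rfl rfl fun _ _ => rfl
    · refine (h.data S).of_agree rfl rfl fun a ha => ?_
      have : a ≠ e := by
        rintro rfl
        exact hS ((h.mem_nodelist a he S).2 (mem_elems.1 ha).2)
      exact Function.update_of_ne this _ _
  · rintro S rest t s' ⟨ht, hq, hnd, hmem, hlev, helt, hnodes, hdata, hqueue⟩
    obtain ⟨hS, hnd'⟩ := List.nodup_cons.1 hnd
    simp only [List.length_cons] at ht hq
    have hmemS := hmem S (by simp)
    refine wp_mono (wp_updateNode hqueue) ?_
    rintro _ t' s'' ⟨ht', h₃, h₄, h₅, h₆, h₇, hq', hqueue'⟩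
    refine ⟨by omega, by omega, hnd', fun S' hS' => hmem S' (by simp [hS']), h₃.trans hlev,
      h₄.trans helt, h₅.trans hnodes, fun S' => ?_, hqueue'⟩
    have hd := hdata S'
    rcases eq_or_ne S' S with rfl | hne
    · rw [if_neg hS]
      rw [if_pos (by simp)] at hd
      exact hd.update_level (mem_elems.2 ⟨he, hmemS⟩) (by rw [h₇, Function.update_self])
        (by rw [h₆, Function.update_self])
    · simp only [List.mem_cons, hne, false_or] at hd
      exact hd.of_agree (by rw [h₇, Function.update_of_ne hne])
        (by rw [h₆, Function.update_of_ne hne]) fun _ _ => rfl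
  · rintro _ t s' ⟨ht, hq, -, -, hlev, helt, hnodes, hdata, hqueue⟩
    simp only [List.length_nil, List.not_mem_nil, if_false] at ht hq hdata
    refine ⟨by omega, ⟨fun S => helt ▸ hdata S, ?_, ?_, ?_, hqueue⟩, hlev, helt, by omega⟩
    · rw [hnodes]; exact h.nodup_nodelist
    · rw [hnodes]; exact h.mem_nodelist
    · rw [hnodes]; exact h.nodelist_nil

/-- The insertion of the element `e` with level `l` into all lists. -/
theorem wp_insertAll {l : ℤ} {L : List ι} (h : Wf I f A X s) (he : e ∉ A)
    (hL : L.Nodup) (hmemL : ∀ S, S ∈ L ↔ e ∈ I.family S) :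
    wp (forEach L fun S => do
        addY S (dual l)
        insertNode e S l
        pushNodelist e S
        enqueueIfUnstable I f S)
      { s with eltLevel := Function.update s.eltLevel e l } fun _ t s' =>
      t ≤ 8 * L.length ∧ Wf I f (insert e A) X s' ∧ s'.level = s.level ∧
        s'.eltLevel = Function.update s.eltLevel e l ∧
        s'.queue.length ≤ s.queue.length + L.length := by
  set v := s.eltLevel with hv
  set v' := Function.update v e l with hv'
  have hve : v' e = l := Function.update_self _ _ _
  refine wp_mono (wp_forEach (fun rest t s' => t + 8 * rest.length ≤ 8 * L.length ∧
    s'.queue.length + rest.length ≤ s.queue.length + L.length ∧ rest.Nodup ∧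
    (∀ S ∈ rest, e ∈ I.family S) ∧ s'.level = s.level ∧ s'.eltLevel = v' ∧
    (∀ a ≠ e, s'.nodelist a = s.nodelist a) ∧ (s'.nodelist e).Nodup ∧
    (∀ S, S ∈ s'.nodelist e ↔ S ∉ rest ∧ e ∈ I.family S) ∧
    (∀ S, DataFor I (if S ∈ rest then A else insert e A) v' s' S) ∧ QueueOK I f X s') ?_ ?_) ?_
  · refine ⟨by omega, by simp, hL, fun S => (hmemL S).1, rfl, rfl, fun _ _ => rfl, ?_, ?_,
      fun S => ?_, h.queue.of_agree subset_rfl rfl rfl (fun _ _ => rfl) fun _ _ => rfl⟩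
    · simp [h.nodelist_nil e he]
    · simp [h.nodelist_nil e he, hmemL]
    · have : DataFor I A v' { s with eltLevel := v' } S := by
        refine (h.data S).of_agree rfl rfl fun a ha => Function.update_of_ne ?_ _ _
        rintro rfl
        exact he (mem_elems.1 ha).1
      split_ifs with hS
      · exact this
      · have hS' : e ∉ I.family S := fun hm => hS ((hmemL S).2 hm)
        refine ⟨this.nodup, ?_, ?_⟩
        · rw [elems_insert_of_notMem hS']; exact this.mem_lists
        · rw [elems_insert_of_notMem hS']; exact this.dual_eq
  · rintro S rest t s' ⟨ht, hq, hnd, hmem, hlev, helt, hnodes, hnn, hnm, hdata, hqueue⟩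
    obtain ⟨hS, hnd'⟩ := List.nodup_cons.1 hnd
    simp only [List.length_cons] at ht hq
    simp only [wp_bind, wp_addY, wp_insertNode, wp_pushNodelist]
    refine wp_mono (wp_enqueueIfUnstable (X := X) ?_) ?_
    · exact hqueue.of_ySet_update rfl rfl (fun S' hS' => by simp [hS']) rfl
    · rintro _ t' s'' ⟨ht', q, b, rfl, hq', hqueue'⟩
      refine ⟨by omega, ?_, hnd', fun S' hS' => hmem S' (by simp [hS']), hlev, helt,
        fun a ha => ?_, ?_, fun S' => ?_, fun S' => ?_, hqueue'⟩
      · simp only at hq' ⊢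
        omega
      · simpa [ha] using hnodes a ha
      · simp [hnm, hnn]
      · rcases eq_or_ne S' S with rfl | hne
        · simp [hS, hmem S' (by simp)]
        · simp [hnm, hne]
      · have hd := hdata S'
        rcases eq_or_ne S' S with rfl | hne
        · rw [if_pos (by simp)] at hd
          rw [if_neg hS]
          exact hd.insert (hmem S' (by simp)) he (by simp [hve]) (by simp [hve])
        · simp only [List.mem_cons, hne, false_or] at hd
          exact hd.of_agree (by simp [hne]) (by simp [hne]) fun _ _ => rfl
  · rintro _ t s' ⟨ht, hq, -, -, hlev, helt, hnodes, hnn, hnm, hdata, hqueue⟩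
    simp only [List.length_nil, List.not_mem_nil, if_false] at ht hq hdata hnm
    refine ⟨by omega, ⟨fun S => helt ▸ hdata S, fun a ha => ?_, fun a ha S => ?_, fun a ha => ?_,
      hqueue⟩, hlev, helt, by omega⟩
    · rcases eq_or_ne a e with rfl | hne
      · exact hnn
      · rw [hnodes a hne]
        exact h.nodup_nodelist a ((Finset.mem_insert.1 ha).resolve_left hne)
    · rcases eq_or_ne a e with rfl | hne
      · simp [hnm]
      · rw [hnodes a hne]
        exact h.mem_nodelist a ((Finset.mem_insert.1 ha).resolve_left hne) S
    · rw [Finset.mem_insert, not_or] at ha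
      rw [hnodes a ha.1]
      exact h.nodelist_nil a ha.2

/-- The deletion of the element `e` from all lists. -/
theorem wp_eraseAll [Fintype ι] (h : Wf I f A X s) (he : e ∈ A) :
    wp (forEach (s.nodelist e) fun S => do
        addY S (-dual (s.eltLevel e))
        deleteNode e S (s.eltLevel e)
        popNodelist e
        enqueueIfUnstable I f S) s fun _ t s' =>
      t ≤ 8 * I.freq e ∧ Wf I f (A.erase e) X s' ∧ s'.level = s.level ∧
        s'.eltLevel = s.eltLevel ∧ s'.queue.length ≤ s.queue.length + I.freq e := by
  have hlen := h.length_nodelist he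
  refine wp_mono (wp_forEach (fun rest t s' => t + 8 * rest.length ≤ 8 * I.freq e ∧
    s'.queue.length + rest.length ≤ s.queue.length + I.freq e ∧ rest.Nodup ∧
    (∀ S ∈ rest, e ∈ I.family S) ∧ s'.level = s.level ∧ s'.eltLevel = s.eltLevel ∧
    (∀ a ≠ e, s'.nodelist a = s.nodelist a) ∧ s'.nodelist e = rest ∧
    (∀ S, DataFor I (if S ∈ rest then A else A.erase e) s.eltLevel s' S) ∧
    QueueOK I f X s') ?_ ?_) ?_
  · refine ⟨by omega, by omega, h.nodup_nodelist e he, fun S => (h.mem_nodelist e he S).1, rfl, rfl,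
      fun _ _ => rfl, rfl, fun S => ?_, h.queue⟩
    split_ifs with hS
    · exact h.data S
    · have hS' : e ∉ I.elems A S := fun hm => hS ((h.mem_nodelist e he S).2 (mem_elems.1 hm).2)
      have : I.elems (A.erase e) S = I.elems A S := by
        rw [elems_erase, Finset.erase_eq_of_notMem hS']
      refine ⟨(h.data S).nodup, ?_, ?_⟩
      · rw [this]; exact (h.data S).mem_lists
      · rw [this]; exact (h.data S).dual_eq
  · rintro S rest t s' ⟨ht, hq, hnd, hmem, hlev, helt, hnodes, hn, hdata, hqueue⟩
    obtain ⟨hS, hnd'⟩ := List.nodup_cons.1 hnd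
    simp only [List.length_cons] at ht hq
    simp only [wp_bind, wp_addY, wp_deleteNode, wp_popNodelist]
    refine wp_mono (wp_enqueueIfUnstable (X := X) ?_) ?_
    · exact hqueue.of_ySet_update rfl rfl (fun S' hS' => by simp [hS']) rfl
    · rintro _ t' s'' ⟨ht', q, b, rfl, hq', hqueue'⟩
      refine ⟨by omega, ?_, hnd', fun S' hS' => hmem S' (by simp [hS']), hlev, helt,
        fun a ha => ?_, ?_, fun S' => ?_, hqueue'⟩
      · simp only at hq' ⊢
        omega
      · simpa [ha] using hnodes a ha
      · simp [hn]
      · have hd := hdata S'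
        rcases eq_or_ne S' S with rfl | hne
        · rw [if_pos (by simp)] at hd
          rw [if_neg hS]
          exact hd.erase (mem_elems.2 ⟨he, hmem S' (by simp)⟩) (by simp) (by simp)
        · simp only [List.mem_cons, hne, false_or] at hd
          exact hd.of_agree (by simp [hne]) (by simp [hne]) fun _ _ => rfl
  · rintro _ t s' ⟨ht, hq, -, -, hlev, helt, hnodes, hn, hdata, hqueue⟩
    simp only [List.length_nil, List.not_mem_nil, if_false] at ht hq hdata
    refine ⟨by omega, ⟨fun S => helt ▸ hdata S, fun a ha => ?_, fun a ha S => ?_, fun a ha => ?_,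
      hqueue⟩, hlev, helt, by omega⟩
    · rw [hnodes a (Finset.ne_of_mem_erase ha)]
      exact h.nodup_nodelist a (Finset.mem_of_mem_erase ha)
    · rw [hnodes a (Finset.ne_of_mem_erase ha)]
      exact h.mem_nodelist a (Finset.mem_of_mem_erase ha) S
    · rcases eq_or_ne a e with rfl | hne
      · exact hn
      · rw [hnodes a hne]
        exact h.nodelist_nil a fun h => ha (Finset.mem_erase.2 ⟨hne, h⟩)

end

section

variable {U ι : Type}

/-! ### The potential for upward moves -/

/-- `2 ^ j` times the dual value of a set at level `j` with the elements `E`, whose levels without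
this set are `v`. -/
def scaledDual (E : Finset U) (v : U → ℤ) (j : ℤ) : ℝ := ∑ e ∈ E, min 1 ((2 : ℝ) ^ (j - v e))

/-- The elements of `E` of level at most `j`. -/
def below (E : Finset U) (v : U → ℤ) (j : ℤ) : Finset U := E.filter fun e => v e ≤ j

variable {E E' : Finset U} {v v' : U → ℤ} {i j l b : ℤ} {M : ℝ}

theorem scaledDual_nonneg : 0 ≤ scaledDual E v j :=
  Finset.sum_nonneg fun _ _ => by positivity

theorem scaledDual_le_card : scaledDual E v j ≤ E.card := by
  refine (Finset.sum_le_card_nsmul E _ 1 fun e _ => min_le_left _ _).trans (by simp)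

theorem card_below_le_scaledDual : ((below E v j).card : ℝ) ≤ scaledDual E v j := by
  rw [below, Finset.card_filter, Nat.cast_sum]
  refine Finset.sum_le_sum fun e _ => ?_
  split_ifs with h
  · have : (1 : ℝ) ≤ 2 ^ (j - v e) := one_le_zpow₀ (by norm_num) (by omega)
    simp [this]
  · simp only [Nat.cast_zero]
    positivity

/-- A term doubles unless it has already reached the cap 1, and the capped terms are those of the
elements of level at most `j`. This recurrence is what makes the potential pay for the elements
touched by an upward move. -/
theorem scaledDual_succ :
    scaledDual E v (j + 1) = 2 * scaledDual E v j - (below E v j).card := by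
  rw [below, Finset.card_filter, Nat.cast_sum, scaledDual, scaledDual, Finset.mul_sum,
    ← Finset.sum_sub_distrib]
  refine Finset.sum_congr rfl fun e _ => ?_
  split_ifs with h
  · have h₁ : (1 : ℝ) ≤ 2 ^ (j - v e) := one_le_zpow₀ (by norm_num) (by omega)
    have h₂ : (1 : ℝ) ≤ 2 ^ (j + 1 - v e) := one_le_zpow₀ (by norm_num) (by omega)
    rw [min_eq_left h₁, min_eq_left h₂]
    norm_num
  · have h₁ : (2 : ℝ) ^ (j - v e) ≤ 1 := zpow_le_one_of_nonpos₀ (by norm_num) (by omega)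
    have h₂ : (2 : ℝ) ^ (j + 1 - v e) ≤ 1 := zpow_le_one_of_nonpos₀ (by norm_num) (by omega)
    rw [min_eq_right h₁, min_eq_right h₂, show j + 1 - v e = (j - v e) + 1 by ring,
      zpow_add_one₀ (by norm_num)]
    simp [mul_comm]

/-- Each uncapped term grows by exactly the factor 2^(j - i), and the cap only helps. -/
theorem scaledDual_le_of_le (hij : i ≤ j) :
    scaledDual E v j ≤ 2 ^ (j - i) * scaledDual E v i := by
  rw [scaledDual, scaledDual, Finset.mul_sum]
  refine Finset.sum_le_sum fun e _ => ?_
  have h₁ : (1 : ℝ) ≤ 2 ^ (j - i) := one_le_zpow₀ (by norm_num) (by omega)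
  rw [mul_min_of_nonneg _ _ (by positivity), mul_one, ← zpow_add₀ (by norm_num),
    show j - i + (i - v e) = j - v e by ring]
  exact min_le_min_right _ h₁

theorem scaledDual_eq (h : ∀ e ∈ E, j ≤ v e) :
    scaledDual E v j = 2 ^ j * ∑ e ∈ E, dual (v e) := by
  rw [scaledDual, Finset.mul_sum]
  refine Finset.sum_congr rfl fun e he => ?_
  have h₁ : (2 : ℝ) ^ (j - v e) ≤ 1 :=
    zpow_le_one_of_nonpos₀ (by norm_num) (by have := h e he; omega)
  rw [min_eq_right h₁, dual, ← zpow_add₀ (by norm_num), sub_eq_add_neg]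

/-- Elements raised to `l` were and remain capped at every level from `l` on, so an upward move of
the set itself does not change the part of φ that matters afterwards. -/
theorem scaledDual_congr_of_max (hv : ∀ e ∈ E, v' e = max l (v e)) (hlj : l ≤ j) :
    scaledDual E v' j = scaledDual E v j := by
  refine Finset.sum_congr rfl fun e he => ?_
  rw [hv e he]
  rcases le_total l (v e) with h | h
  · rw [max_eq_right h]
  · have h₁ : (1 : ℝ) ≤ 2 ^ (j - v e) := one_le_zpow₀ (by norm_num) (by omega)
    have h₂ : (1 : ℝ) ≤ 2 ^ (j - l) := one_le_zpow₀ (by norm_num) (by omega)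
    rw [max_eq_left h, min_eq_left h₁, min_eq_left h₂]

theorem scaledDual_anti (hv : ∀ e ∈ E, v e ≤ v' e) : scaledDual E v' j ≤ scaledDual E v j := by
  refine Finset.sum_le_sum fun e he => min_le_min_left _ ?_
  exact zpow_le_zpow_right₀ (by norm_num) (by have := hv e he; omega)

theorem scaledDual_mono (h : E' ⊆ E) : scaledDual E' v j ≤ scaledDual E v j :=
  Finset.sum_le_sum_of_subset_of_nonneg h fun _ _ _ => by positivity

theorem scaledDual_congr (hv : ∀ e ∈ E, v' e = v e) : scaledDual E v' j = scaledDual E v j :=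
  Finset.sum_congr rfl fun e he => by rw [hv e he]

theorem scaledDual_insert_le {e : U} : scaledDual (insert e E) v j ≤ scaledDual E v j + 1 := by
  by_cases he : e ∈ E
  · rw [Finset.insert_eq_of_mem he]; linarith
  · rw [scaledDual, Finset.sum_insert he, add_comm]
    exact add_le_add le_rfl (min_le_left _ _)

/-- If the levels change only for the elements of `F`, the scaled dual values grow by at most the
number of elements of `F`. -/
theorem scaledDual_le_add_card {F : Finset U} (hv : ∀ e ∈ E, e ∉ F → v' e = v e) :
    scaledDual E v' j ≤ scaledDual E v j + (E ∩ F).card := by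
  have : ((E ∩ F).card : ℝ) = ∑ e ∈ E, if e ∈ F then (1 : ℝ) else 0 := by
    rw [← Finset.sum_filter, Finset.sum_const, Finset.filter_mem_eq_inter]
    simp
  rw [this, scaledDual, scaledDual, ← Finset.sum_add_distrib]
  refine Finset.sum_le_sum fun e he => ?_
  split_ifs with h
  · have : (0 : ℝ) ≤ min 1 (2 ^ (j - v e)) := by positivity
    linarith [min_le_left (1 : ℝ) (2 ^ (j - v' e))]
  · rw [hv e he h, add_zero]

/-- The potential that pays for the upward moves of a set at level `l` with base level `b`. -/
def upPotential (E : Finset U) (v : U → ℤ) (M : ℝ) (b l : ℤ) : ℝ :=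
  ⨆ p : ℕ × ℕ, max 0 ((scaledDual E v (l + 1 + p.1) - 2 ^ (l + 1 + p.1) * M) +
    20 * (scaledDual E v (l + p.2) - 2 ^ (l + p.2) * M / 2) - (l - b))

theorem upPotential_le {x : ℝ} (hx : 0 ≤ x) (h : ∀ i j, l < i → l ≤ j →
    (scaledDual E v i - 2 ^ i * M) + 20 * (scaledDual E v j - 2 ^ j * M / 2) - (l - b) ≤ x) :
    upPotential E v M b l ≤ x :=
  ciSup_le fun p => max_le hx (h _ _ (by omega) (by omega))

/-- The real supremum is meaningful only for a bounded family; φ never exceeds the number of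
elements, which gives 1 + 20 = 21 per element. -/
theorem bddAbove_upPotential (hM : 0 ≤ M) :
    BddAbove (Set.range fun p : ℕ × ℕ => max 0 ((scaledDual E v (l + 1 + p.1) -
      2 ^ (l + 1 + p.1) * M) + 20 * (scaledDual E v (l + p.2) - 2 ^ (l + p.2) * M / 2) -
        (l - b))) := by
  refine ⟨max 0 (21 * E.card - (l - b)), ?_⟩
  rintro _ ⟨p, rfl⟩
  refine max_le_max le_rfl ?_
  have h₁ : (0 : ℝ) ≤ 2 ^ (l + 1 + p.1) * M := by positivity
  have h₂ : (0 : ℝ) ≤ 2 ^ (l + p.2) * M := by positivity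
  have h₃ := scaledDual_le_card (E := E) (v := v) (j := l + 1 + p.1)
  have h₄ := scaledDual_le_card (E := E) (v := v) (j := l + p.2)
  linarith

theorem upPotential_nonneg : 0 ≤ upPotential E v M b l :=
  Real.iSup_nonneg fun _ => le_max_left _ _

theorem le_upPotential (hM : 0 ≤ M) (hi : l < i) (hj : l ≤ j) :
    (scaledDual E v i - 2 ^ i * M) + 20 * (scaledDual E v j - 2 ^ j * M / 2) - (l - b) ≤
      upPotential E v M b l := by
  obtain ⟨m, rfl⟩ := Int.le.dest (show l + 1 ≤ i by omega)
  obtain ⟨n, rfl⟩ := Int.le.dest hj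
  exact (le_max_right _ _).trans (le_ciSup (bddAbove_upPotential hM) (m, n))

/-- The factor 21 is the sum of the weights 1 and 20 with which φ enters the potential. -/
theorem upPotential_le_add {δ : ℝ} (hM : 0 ≤ M) (hδ : 0 ≤ δ)
    (h : ∀ j, l ≤ j → scaledDual E' v' j ≤ scaledDual E v j + δ) :
    upPotential E' v' M b l ≤ upPotential E v M b l + 21 * δ := by
  refine upPotential_le (by linarith [upPotential_nonneg (E := E) (v := v) (M := M) (b := b) (l := l)])
    fun i j hi hj => ?_
  have := le_upPotential (E := E) (v := v) (b := b) hM hi hj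
  linarith [h i hi.le, h j hj]

/-- φ at most doubles from level to level while 2^j M exactly doubles, so the bound at `l` persists
at all higher levels and every summand is nonpositive. -/
theorem upPotential_eq_zero (hbl : b ≤ l) (h : scaledDual E v l ≤ 2 ^ l * M / 2) :
    upPotential E v M b l = 0 := by
  refine le_antisymm (upPotential_le le_rfl fun i j hi hj => ?_) upPotential_nonneg
  have key : ∀ j, l ≤ j → scaledDual E v j ≤ 2 ^ j * M / 2 := fun j hj => by
    refine (scaledDual_le_of_le hj).trans ?_
    calc (2 : ℝ) ^ (j - l) * scaledDual E v l ≤ 2 ^ (j - l) * (2 ^ l * M / 2) := by gcongr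
      _ = 2 ^ (j - l + l) * M / 2 := by rw [zpow_add₀ (by norm_num)]; ring
      _ = 2 ^ j * M / 2 := by rw [sub_add_cancel]
  have h₁ := key i hi.le
  have h₂ := key j hj
  have h₃ := scaledDual_nonneg (E := E) (v := v) (j := i)
  have h₄ : (b : ℝ) ≤ l := by exact_mod_cast hbl
  linarith

/-- An upward move from level `l` to level `l'` is paid by the potential of the set. -/
theorem upPotential_up {l' : ℤ} (hM : 1 / 4 < 2 ^ b * M) (hbl : b ≤ l) (hll' : l < l')
    (hbefore : 2 ^ (l' - 1) * M < scaledDual E v (l' - 1))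
    (hafter : scaledDual E v l' ≤ 2 ^ l' * M) (hv : ∀ e ∈ E, v' e = max l' (v e)) :
    upPotential E v' M b l' + (below E v l').card + (l' - l) ≤ upPotential E v M b l := by
  have hM0 : 0 < M := by
    have : (0 : ℝ) < 2 ^ b * M := by linarith
    exact pos_of_mul_pos_right this (by positivity)
  have hpow : (2 : ℝ) ^ l' = 2 * 2 ^ (l' - 1) := by
    rw [← zpow_one_add₀ (by norm_num)]; congr 1; ring
  have hN := card_below_le_scaledDual (E := E) (v := v) (j := l')
  suffices H : upPotential E v' M b l' ≤
      upPotential E v M b l - (below E v l').card - (l' - l) by linarith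
  refine upPotential_le ?_ fun i j hi hj => ?_
  -- If the new potential is 0, the old one is tested at the pair (l', l' - 1). With P = 2^(l'-1) M
  -- the second summand exceeds 20 (P - P/2) = 10 P and the first is at least N - 2 P. The remaining
  -- 8 P exceeds 2^(l'-b) ≥ l' - b because 2^b M > 1/4.
  · have h₁ := le_upPotential (E := E) (v := v) (b := b) hM0.le hll' (show l ≤ l' - 1 by omega)
    obtain ⟨n, hn⟩ := Int.le.dest (show b ≤ l' by omega)
    have h₂ : (1 : ℝ) / 4 * 2 ^ n < 2 ^ l' * M := by
      rw [← hn, zpow_add₀ (by norm_num), zpow_natCast]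
      calc (1 : ℝ) / 4 * 2 ^ n < 2 ^ b * M * 2 ^ n := by gcongr
        _ = _ := by ring
    have h₃ : (n : ℝ) ≤ 2 ^ n := by exact_mod_cast Nat.lt_two_pow_self.le
    have h₄ : (l' : ℝ) = b + n := by exact_mod_cast hn.symm
    rw [hpow] at *
    linarith
  -- Otherwise the pair (i, j) is compared with the old pair (l', j). As φ(l') ≤ 2^l' M, the excess
  -- φ(i) - 2^i M is largest at i = l' + 1, where the recurrence gives 2 (φ(l') - 2^l' M) - N ≤
  -- (φ(l') - 2^l' M) - N.
  · rw [scaledDual_congr_of_max hv hi.le, scaledDual_congr_of_max hv hj]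
    have h₁ := le_upPotential (E := E) (v := v) (b := b) hM0.le hll' (show l ≤ j by omega)
    have h₂ : scaledDual E v i - 2 ^ i * M ≤ scaledDual E v (l' + 1) - 2 ^ (l' + 1) * M := by
      have h₃ := scaledDual_le_of_le (E := E) (v := v) (show l' + 1 ≤ i by omega)
      have h₄ : scaledDual E v (l' + 1) ≤ 2 ^ (l' + 1) * M := by
        rw [scaledDual_succ, zpow_add_one₀ (by norm_num)]
        have : (0 : ℝ) ≤ (below E v l').card := by positivity
        linarith
      have h₅ : (1 : ℝ) ≤ 2 ^ (i - (l' + 1)) := one_le_zpow₀ (by norm_num) (by omega)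
      have h₆ : (2 : ℝ) ^ i = 2 ^ (i - (l' + 1)) * 2 ^ (l' + 1) := by
        rw [← zpow_add₀ (by norm_num)]; congr 1; ring
      rw [h₆]
      nlinarith [mul_nonneg (sub_nonneg.2 h₅) (sub_nonneg.2 h₄)]
    rw [scaledDual_succ, zpow_add_one₀ (by norm_num)] at h₂
    linarith

end

section

variable {U ι : Type}

variable {I : SetSystem U ι} {f : ℕ} {A : Finset U} {X : Set ι} {s : Store U ι} {S : ι} {e : U}
  {E : Finset U} {v : U → ℤ}

/-! ### Upward moves -/

theorem SetSystem.dual_pos (l : ℤ) : 0 < dual l := by rw [dual]; positivity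

theorem SetSystem.zpow_mul_dual (l : ℤ) : (2 : ℝ) ^ l * dual l = 1 := by
  rw [dual, ← zpow_add₀ (by norm_num)]; simp

theorem SetSystem.dual_add_one (l : ℤ) : dual (l + 1) = dual l / 2 := by
  rw [dual, dual, neg_add, zpow_add₀ (by norm_num), zpow_neg_one]; rfl

theorem card_eq_card_below {l : ℤ} {L : List U} (hL : L.Nodup)
    (hmem : ∀ e, e ∈ L ↔ e ∈ E ∧ v e ≤ l) : L.length = (below E v l).card := by
  rw [← List.toFinset_card_of_nodup hL]
  congr 1
  ext e
  simp [hmem, below]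

/-- The two summands are what the inner loop of an upward move keeps as running sums. -/
theorem scaledDual_eq_of_split (l : ℤ) : scaledDual E v l = 2 ^ l *
    (dual l * (below E v l).card + ∑ e ∈ E.filter fun e => l < v e, dual (v e)) := by
  rw [mul_add, ← mul_assoc, zpow_mul_dual, one_mul, scaledDual,
    ← Finset.sum_filter_add_sum_filter_not E fun e => v e ≤ l]
  congr 1
  · rw [below, Finset.card_eq_sum_ones, Nat.cast_sum]
    refine Finset.sum_congr rfl fun e he => ?_
    have h₁ : (1 : ℝ) ≤ 2 ^ (l - v e) :=
      one_le_zpow₀ (by norm_num) (by have := (Finset.mem_filter.1 he).2; omega)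
    simp [h₁]
  · simp only [not_le]
    have h := scaledDual_eq (E := E.filter fun e => l < v e) (v := v) (j := l)
      fun e he => (Finset.mem_filter.1 he).2.le
    rw [← h, scaledDual]

theorem sum_above_succ (l : ℤ) : ∑ e ∈ E.filter (fun e => l + 1 < v e), dual (v e) =
    (∑ e ∈ E.filter fun e => l < v e, dual (v e)) -
      dual (l + 1) * (E.filter fun e => v e = l + 1).card := by
  have h : (E.filter fun e => l < v e) =
      (E.filter fun e => l + 1 < v e) ∪ E.filter fun e => v e = l + 1 := by
    ext e
    simp only [Finset.mem_filter, Finset.mem_union]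
    constructor
    · rintro ⟨h₁, h₂⟩
      rcases eq_or_ne (v e) (l + 1) with h | h
      · exact .inr ⟨h₁, h⟩
      · exact .inl ⟨h₁, by omega⟩
    · rintro (⟨h₁, h₂⟩ | ⟨h₁, h₂⟩) <;> exact ⟨h₁, by omega⟩
  rw [h, Finset.sum_union]
  · have : ∑ e ∈ E.filter (fun e => v e = l + 1), dual (v e) =
        dual (l + 1) * (E.filter fun e => v e = l + 1).card := by
      rw [Finset.sum_congr rfl fun e he => by rw [(Finset.mem_filter.1 he).2], Finset.sum_const,
        nsmul_eq_mul, mul_comm]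
    rw [this]; ring
  · rw [Finset.disjoint_left]
    intro e h₁ h₂
    have := (Finset.mem_filter.1 h₁).2
    have := (Finset.mem_filter.1 h₂).2
    omega

/-- The inner loop of an upward move finds the lowest level at which the dual value is at most
`β c_S`. -/
theorem wp_loop_upStep {l₀ : ℤ} {out : List U} {yOut yIn : ℝ}
    (h : ∀ k, (s.lists S k).Nodup)
    (hmem : ∀ k e, e ∈ s.lists S k ↔ e ∈ E ∧ v e = k) (hM : 0 < beta f * I.cost S)
    (hl₀ : s.level S = l₀)
    (hout : out.Nodup) (hmemout : ∀ e, e ∈ out ↔ e ∈ E ∧ v e ≤ l₀)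
    (hyOut : yOut = dual l₀ * out.length) (hyIn : yIn = ∑ e ∈ E.filter fun e => l₀ < v e, dual (v e))
    (hy : 2 ^ l₀ * (beta f * I.cost S) < scaledDual E v l₀) :
    wp (loop (upStep I f S) (l₀, yOut, yIn, out)) s fun r t s' =>
      l₀ < r.1 ∧ s' = { s with level := Function.update s.level S r.1 } ∧ r.2.Nodup ∧
      (∀ e, e ∈ r.2 ↔ e ∈ E ∧ v e ≤ r.1) ∧
      2 ^ (r.1 - 1) * (beta f * I.cost S) < scaledDual E v (r.1 - 1) ∧
      scaledDual E v r.1 ≤ 2 ^ r.1 * (beta f * I.cost S) ∧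
      (t : ℤ) + out.length = 3 * (r.1 - l₀) + r.2.length := by
  set M := beta f * I.cost S with hMdef
  -- At level `n₀` even 2^n₀ M exceeds the number of elements, hence φ; so the loop stops by then,
  -- and the distance to `n₀` serves as the variant.
  obtain ⟨n₀, hn₀⟩ := pow_unbounded_of_one_lt (E.card / M) (one_lt_two (α := ℝ))
  rw [div_lt_iff₀ hM] at hn₀
  refine wp_loop (fun n z t s' => n = ((n₀ : ℤ) - z.1).toNat ∧ l₀ ≤ z.1 ∧
    s' = { s with level := Function.update s.level S z.1 } ∧ z.2.2.2.Nodup ∧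
    (∀ e, e ∈ z.2.2.2 ↔ e ∈ E ∧ v e ≤ z.1) ∧ z.2.1 = dual z.1 * z.2.2.2.length ∧
    z.2.2.1 = (∑ e ∈ E.filter fun e => z.1 < v e, dual (v e)) ∧
    2 ^ z.1 * M < scaledDual E v z.1 ∧
    (t : ℤ) + out.length = 3 * (z.1 - l₀) + z.2.2.2.length)
    (n := ((n₀ : ℤ) - l₀).toNat) ?_ ?_
  · refine ⟨rfl, le_rfl, ?_, hout, hmemout, hyOut, hyIn, hy, by simp⟩
    simp only [← hl₀, Function.update_eq_self]
  · rintro n ⟨l, yOut, yIn, o⟩ t s' ⟨hn, hl, rfl, ho, hmemo, hyo, hyi, hy, ht⟩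
    simp only at hn hl ho hmemo hyo hyi hy ht
    simp only [upStep, wp_bind, wp_writeLevel, wp_readList]
    set inl := s.lists S (l + 1) with hinl
    -- The traversal pushes the entries onto `out` in reverse order. An iteration costs three steps
    -- besides this traversal: the write, the read of the list, and the loop step.
    refine wp_mono (wp_foldEach (fun rest a t' s' => t' + rest.length = inl.length ∧
      s' = { s with level := Function.update s.level S (l + 1) } ∧
      a.1 + rest.length = inl.length ∧ a.2.reverse ++ rest = o.reverse ++ inl) ?_ ?_) ?_
    · exact ⟨by simp, by simp, by simp, rfl⟩
    · rintro x rest a t' s' ⟨h₁, rfl, h₃, h₄⟩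
      rw [wp_pure]
      simp only [List.length_cons] at h₁ h₃
      exact ⟨by omega, rfl, by simp only; omega, by simp [← h₄]⟩
    · rintro ⟨k, o'⟩ t' s' ⟨h₁, rfl, h₃, h₄⟩
      simp only [List.length_nil, add_zero, List.append_nil] at h₁ h₃ h₄
      obtain rfl : o' = inl.reverse ++ o := by
        rw [← List.reverse_inj, h₄]; simp
      have hmemo' : ∀ e, e ∈ inl.reverse ++ o ↔ e ∈ E ∧ v e ≤ l + 1 := by
        intro e
        rw [List.mem_append, List.mem_reverse, hinl, hmem, hmemo]
        constructor
        · rintro (⟨h₁, h₂⟩ | ⟨h₁, h₂⟩) <;> exact ⟨h₁, by omega⟩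
        · rintro ⟨h₁, h₂⟩
          rcases eq_or_ne (v e) (l + 1) with h | h
          · exact .inl ⟨h₁, h⟩
          · exact .inr ⟨h₁, by omega⟩
      have hnd : (inl.reverse ++ o).Nodup := by
        refine List.Nodup.append (List.nodup_reverse.2 (h _)) ho fun e h₁ h₂ => ?_
        have := ((hmem _ _).1 (List.mem_reverse.1 h₁)).2
        have := ((hmemo _).1 h₂).2
        omega
      have hk : (k : ℝ) = inl.length := by exact_mod_cast h₃
      have hcard : inl.length = (E.filter fun e => v e = l + 1).card := by
        rw [← List.toFinset_card_of_nodup (h _)]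
        congr 1
        ext e
        simp [hmem]
      have hyo' : yOut / 2 + dual (l + 1) * k = dual (l + 1) * (inl.reverse ++ o).length := by
        rw [hyo, dual_add_one, hk, List.length_append, List.length_reverse]
        push_cast
        ring
      have hyi' : yIn - dual (l + 1) * k = ∑ e ∈ E.filter fun e => l + 1 < v e, dual (v e) := by
        rw [sum_above_succ, hyi, hk, hcard]
      have hsplit : scaledDual E v (l + 1) =
          2 ^ (l + 1) * (yOut / 2 + dual (l + 1) * k + (yIn - dual (l + 1) * k)) := by
        rw [scaledDual_eq_of_split, hyo', hyi', card_eq_card_below hnd hmemo']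
      have hlen : ((inl.reverse ++ o).length : ℤ) = inl.length + o.length := by simp
      have hn₀l : l < n₀ := by
        by_contra hlt
        have h₅ : (2 : ℝ) ^ (n₀ : ℤ) ≤ 2 ^ l := zpow_le_zpow_right₀ (by norm_num) (not_lt.1 hlt)
        rw [zpow_natCast] at h₅
        have h₆ := scaledDual_le_card (E := E) (v := v) (j := l)
        nlinarith
      rw [wp_ite, wp_pure, wp_pure]
      refine ⟨fun hle => ⟨?_, by simp⟩, fun hgt => ⟨by simp, ?_⟩⟩
      · rintro _ ⟨⟩
        refine ⟨by simp only; omega, rfl, hnd, hmemo', by simpa using hy, ?_, ?_⟩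
        · simp only [hsplit]
          gcongr
        · simp only [hlen]
          push_cast
          omega
      · rintro _ ⟨⟩
        refine ⟨_, ?_, rfl, by simp only; omega, rfl, hnd, hmemo', hyo', hyi', ?_, ?_⟩
        · simp only; omega
        · simp only [hsplit]
          exact mul_lt_mul_of_pos_left (not_le.1 hgt) (by positivity)
        · simp only [hlen]
          push_cast
          omega

theorem one_le_of_freq [Fintype ι] (hf : I.freq e ≤ f) : 1 ≤ f :=
  (Nat.succ_le_of_lt (Finset.card_pos.2 (I.setsOf_nonempty e))).trans hf

theorem SetSystem.beta_pos (hf : 1 ≤ f) : 0 < beta f := by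
  have : (1 : ℝ) ≤ f := by exact_mod_cast hf
  rw [beta]; linarith

theorem SetSystem.beta_mul_cost_pos (hf : 1 ≤ f) : 0 < beta f * I.cost S :=
  mul_pos (beta_pos hf) (I.cost_pos S)

/-- This is β² = 1024 f², the gap between the two stability thresholds that makes a downward move
affordable. -/
theorem SetSystem.cost_div_beta_le (hf : 1 ≤ f) :
    I.cost S / beta f ≤ beta f * I.cost S / (1024 * f ^ 2) := by
  have h : (1 : ℝ) ≤ f := by exact_mod_cast hf
  apply le_of_eq
  rw [beta]
  field_simp
  norm_num

theorem SetSystem.cost_div_beta_le' (hf : 1 ≤ f) :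
    I.cost S / beta f ≤ beta f * I.cost S / 1024 := by
  have h : (1 : ℝ) ≤ f := by exact_mod_cast hf
  refine (cost_div_beta_le hf).trans ?_
  have := (beta_mul_cost_pos (I := I) (S := S) hf).le
  gcongr
  nlinarith

/-- An upward move of the set `S`. -/
theorem wp_moveUp [Fintype ι] (h : Wf I f A {S} s) (hf1 : 1 ≤ f) (hf : ∀ e ∈ A, I.freq e ≤ f)
    (hlev : ∀ e ∈ I.elems A S, s.level S ≤ s.eltLevel e)
    (hy : beta f * I.cost S < s.ySet S) :
    wp (moveUp I f S) s fun _ t s' => ∃ l', s.level S < l' ∧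
      2 ^ (l' - 1) * (beta f * I.cost S) < scaledDual (I.elems A S) s.eltLevel (l' - 1) ∧
      scaledDual (I.elems A S) s.eltLevel l' ≤ 2 ^ l' * (beta f * I.cost S) ∧
      s'.level = Function.update s.level S l' ∧
      (∀ e, s'.eltLevel e =
        if e ∈ I.elems A S ∧ s.eltLevel e ≤ l' then l' else s.eltLevel e) ∧
      Wf I f A ∅ s' ∧
      (t : ℤ) ≤ 3 + 3 * (l' - s.level S) +
        (6 + 8 * f) * (below (I.elems A S) s.eltLevel l').card ∧
      s'.queue.length ≤ s.queue.length + f * (below (I.elems A S) s.eltLevel l').card := by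
  set M := beta f * I.cost S with hMdef
  have hM : 0 < M := beta_mul_cost_pos hf1
  set E := I.elems A S with hE
  set v := s.eltLevel with hv
  set l₀ := s.level S with hl₀
  set out := s.lists S l₀ with hout
  have hd := h.data S
  have hmemout : ∀ e, e ∈ out ↔ e ∈ E ∧ v e ≤ l₀ := fun e => by
    rw [hout, hd.mem_lists]
    refine and_congr_right fun he => ⟨fun h => h.le, fun h => le_antisymm h (hlev e he)⟩
  simp only [moveUp, wp_bind, wp_readLevel, wp_readY, wp_readList]
  refine wp_mono (wp_foldEach (fun rest a t' s' => t' + 2 * rest.length = 2 * out.length ∧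
    s' = s ∧ (∀ e ∈ rest, e ∈ out) ∧ a + dual l₀ * rest.length = dual l₀ * out.length) ?_ ?_) ?_
  · exact ⟨Nat.zero_add _, rfl, fun _ => id, zero_add _⟩
  · rintro e rest a t' s' ⟨h₁, rfl, h₂, h₃⟩
    simp only [wp_bind, wp_readEltLevel, wp_pure, List.length_cons] at h₁ h₃ ⊢
    refine ⟨by omega, trivial, fun e he => h₂ e (by simp [he]), ?_⟩
    rw [((hd.mem_lists _ _).1 (h₂ e (by simp))).2, ← h₃]
    push_cast
    ring
  rintro yOut t₁ s' ⟨ht₁, rfl, -, hyOut⟩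
  simp only [List.length_nil, mul_zero, add_zero, Nat.cast_zero] at ht₁ hyOut
  have hsplit := scaledDual_eq_of_split (E := E) (v := v) l₀
  rw [scaledDual_eq hlev, mul_right_inj' (by positivity), ← hd.dual_eq,
    ← card_eq_card_below (hd.nodup l₀) hmemout, ← hyOut] at hsplit
  refine wp_mono (wp_loop_upStep (E := E) (v := v) (l₀ := l₀) hd.nodup hd.mem_lists hM rfl
    (hd.nodup l₀) hmemout hyOut (by rw [hsplit]; ring) ?_) ?_
  · rw [scaledDual_eq hlev, ← hd.dual_eq]
    gcongr
  rintro ⟨l', o⟩ t₂ s₁ ⟨hll', hs₁, hond, hmemo, hbefore, hafter, ht₂⟩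
  simp only at hll' hs₁ hond hmemo hbefore hafter ht₂
  have hcard := card_eq_card_below hond hmemo
  -- Per element: one traversal step, one read, one write, and at most 1 + 8 f steps of
  -- `updateDual`. The first pass over the old out-list adds at most 2 more per element after the
  -- cost of the inner loop is offset, since that list is part of the new one.
  refine wp_mono (wp_forEach (fun rest t s'' => t + (4 + 8 * f) * rest.length ≤
      (4 + 8 * f) * o.length ∧ s''.queue.length + f * rest.length ≤ s'.queue.length + f * o.length ∧
    s''.level = Function.update s'.level S l' ∧ rest.Nodup ∧ (∀ e ∈ rest, e ∈ o) ∧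
    (∀ e, s''.eltLevel e = if e ∈ E ∧ v e ≤ l' ∧ e ∉ rest then l' else v e) ∧
    Wf I f A {S} s'') ?_ ?_) ?_
  · refine ⟨(zero_add _).le, by rw [hs₁], by rw [hs₁], hond, fun _ => id, fun e => ?_, ?_⟩
    · rw [if_neg, hs₁]
      rintro ⟨h₁, h₂, h₃⟩
      exact h₃ ((hmemo e).2 ⟨h₁, h₂⟩)
    · rw [hs₁]
      refine ⟨fun S' => (h.data S').of_agree rfl rfl fun _ _ => rfl, h.nodup_nodelist,
        h.mem_nodelist, h.nodelist_nil,
        h.queue.of_agree subset_rfl rfl rfl (fun _ _ => rfl) fun S' hS' => ?_⟩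
      exact Function.update_of_ne hS' _ _
  · rintro e rest t s'' ⟨h₁, h₂, h₃, h₄, h₅, h₆, h₇⟩
    simp only [wp_bind, wp_readEltLevel, wp_writeEltLevel]
    have heo : e ∈ E ∧ v e ≤ l' := (hmemo e).1 (h₅ e (by simp))
    have heA := (mem_elems.1 heo.1).1
    refine wp_mono (wp_updateDual h₇ heA (hf e heA)) ?_
    rintro _ t' s₃ ⟨g₁, g₂, g₃, g₄, g₅⟩
    rw [List.nodup_cons] at h₄
    simp only [List.length_cons] at h₁ h₂
    refine ⟨by linarith, by linarith, g₃.trans h₃, h₄.2, fun a ha => h₅ a (by simp [ha]),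
      fun a => ?_, g₂⟩
    rw [g₄]
    rcases eq_or_ne a e with rfl | hae
    · rw [Function.update_self, if_pos ⟨heo.1, heo.2, h₄.1⟩]
    · rw [Function.update_of_ne hae, h₆]
      simp [hae]
  · rintro _ t₃ s₃ ⟨g₁, g₂, g₃, -, -, g₆, g₇⟩
    simp only [List.length_nil, mul_zero, add_zero, List.not_mem_nil, not_false_eq_true,
      and_true] at g₁ g₂ g₆
    refine ⟨l', hll', hbefore, hafter, g₃, g₆, ⟨g₇.data, g₇.nodup_nodelist, g₇.mem_nodelist,
      g₇.nodelist_nil, g₇.queue.mem_queue, fun S' _ hu => ?_⟩, ?_, ?_⟩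
    -- Since `l'` is the first admissible level, φ(l') ≥ φ(l' - 1) > 2^(l'-1) M, so y(S) > M/2 after
    -- the move. Together with y(S) ≤ M this makes `S` stable, and its exemption ends.
    · by_cases hS' : S' = S
      · exfalso
        subst hS'
        have hmax : ∀ e ∈ E, s₃.eltLevel e = max l' (v e) := fun e he => by
          rw [g₆]
          split_ifs with hc
          · rw [max_eq_left hc.2]
          · rw [max_eq_right]
            by_contra hlt
            exact hc ⟨he, by omega⟩
        have hz : scaledDual E v l' = 2 ^ l' * s₃.ySet S' := by
          rw [(g₇.data S').dual_eq, ← scaledDual_eq fun e he => by rw [hmax e he]; exact le_max_left _ _,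
            scaledDual_congr_of_max hmax le_rfl]
        have hz' := scaledDual_succ (E := E) (v := v) (j := l' - 1)
        have hN := card_below_le_scaledDual (E := E) (v := v) (j := l' - 1)
        have hpow : (2 : ℝ) ^ l' = 2 * 2 ^ (l' - 1) := by
          rw [← zpow_one_add₀ (by norm_num)]; congr 1; ring
        rw [sub_add_cancel] at hz'
        have hc := cost_div_beta_le' (I := I) (S := S') hf1
        rw [← hMdef] at hc
        have hp : (0 : ℝ) < 2 ^ l' := by positivity
        rcases hu with hu | ⟨hu, -⟩
        · have := mul_lt_mul_of_pos_left hu hp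
          linarith
        · have : 2 ^ l' * s₃.ySet S' < 2 ^ l' * (M / 2) :=
            mul_lt_mul_of_pos_left (by linarith) hp
          rw [hpow] at this hz
          linarith
      · exact g₇.queue.inQueue S' hS' hu
    · have hN : ((below E v l₀).card : ℤ) ≤ (below E v l').card := by
        have : below E v l₀ ⊆ below E v l' := fun e he => by
          rw [below, Finset.mem_filter] at *
          exact ⟨he.1, by omega⟩
        exact_mod_cast Finset.card_le_card this
      have hco := card_eq_card_below (hd.nodup l₀) hmemout
      zify at g₁ ht₁ hcard hco
      push_cast
      rw [← hout] at hco
      rw [hcard] at g₁ ht₂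
      rw [hco] at ht₁ ht₂
      linarith
    · rw [← hcard]; exact g₂

end

section

variable {U ι : Type}

variable {I : SetSystem U ι} {f : ℕ} {A : Finset U} {X : Set ι} {s : Store U ι} {S : ι} {e : U}
  {E : Finset U} {v : U → ℤ}

/-! ### Downward moves -/

/-- The active elements of `S` whose level is the level of `S`. -/
def outSet (I : SetSystem U ι) (A : Finset U) (s : Store U ι) (S : ι) : Finset U :=
  (I.elems A S).filter fun e => s.eltLevel e = s.level S

/-- The elements whose level decreases when `S` moves down by one level. -/
def lowered (I : SetSystem U ι) (A : Finset U) (s : Store U ι) (S : ι) : Finset U :=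
  (outSet I A s S).filter fun e => ∀ S', e ∈ I.family S' →
    Function.update s.level S (s.level S - 1) S' < s.level S

theorem mem_lowered : e ∈ lowered I A s S ↔ e ∈ outSet I A s S ∧ ∀ S', e ∈ I.family S' →
    Function.update s.level S (s.level S - 1) S' < s.level S := Finset.mem_filter

/-- Well-formedness refers to the recorded levels of the elements; the level of a set enters only
through its own stability. -/
theorem Wf.of_level_update {l : ℤ} (h : Wf I f A X s) (hX : X ⊆ {S}) :
    Wf I f A {S} { s with level := Function.update s.level S l } :=
  ⟨fun S' => (h.data S').of_agree rfl rfl fun _ _ => rfl, h.nodup_nodelist,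
    h.mem_nodelist, h.nodelist_nil,
    h.queue.of_agree hX rfl rfl (fun _ _ => rfl) fun _ hS' => Function.update_of_ne hS' _ _⟩

theorem DataFor.toFinset_lists (h : DataFor I A s.eltLevel s S) :
    (s.lists S (s.level S)).toFinset = outSet I A s S := by
  ext e
  simp [outSet, h.mem_lists]

theorem DataFor.length_lists (h : DataFor I A s.eltLevel s S) :
    (s.lists S (s.level S)).length = (outSet I A s S).card := by
  rw [← List.toFinset_card_of_nodup (h.nodup _), h.toFinset_lists]

variable [Fintype ι]

/-- The four fixed steps are two reads, the write of the level and the final read of y(S). An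
element of the out-list costs 4 + 2 f steps for finding out whether another set keeps it up and for
writing its level, plus 8 f in `updateDual`. -/
theorem wp_downStep (h : Wf I f A {S} s) (hf : ∀ e ∈ A, I.freq e ≤ f) :
    wp (downStep I f S) s fun r t s' =>
      (outSet I A s S = ∅ ∧ r = .inl () ∧ t = 3 ∧
        s' = { s with level := Function.update s.level S (I.base f S) }) ∨
      ((outSet I A s S).Nonempty ∧
        s'.level = Function.update s.level S (s.level S - 1) ∧
        (∀ e, s'.eltLevel e = if e ∈ lowered I A s S then s.level S - 1 else s.eltLevel e) ∧
        Wf I f A {S} s' ∧ t ≤ 4 + (4 + 10 * f) * (outSet I A s S).card ∧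
        s'.queue.length ≤ s.queue.length + f * (outSet I A s S).card ∧
        (r = .inr () ∧ s'.ySet S < I.cost S / beta f ∧ I.base f S < s.level S - 1 ∨
          r = .inl () ∧ ¬ (s'.ySet S < I.cost S / beta f ∧ I.base f S < s.level S - 1))) := by
  have hd := h.data S
  have hlen := hd.length_lists
  set l := s.level S with hl
  set v := s.eltLevel with hv
  set lev := Function.update s.level S (l - 1) with hlev
  simp only [downStep, wp_bind, wp_readLevel, wp_readList, wp_ite, wp_writeLevel, wp_pure]
  refine ⟨fun hnil => .inl ⟨?_, trivial, trivial, rfl⟩, fun hne => ?_⟩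
  · rw [← Finset.card_eq_zero, ← hlen, hl, hnil, List.length_nil]
  set out := s.lists S l with hout
  have hmemout : ∀ e ∈ out, e ∈ I.elems A S ∧ v e = l := fun e => (hd.mem_lists l e).1
  refine wp_mono (wp_forEach (fun rest t s' => t + (4 + 10 * f) * rest.length ≤
      (4 + 10 * f) * out.length ∧
    s'.queue.length + f * rest.length ≤ s.queue.length + f * out.length ∧
    s'.level = lev ∧ rest.Nodup ∧ (∀ e ∈ rest, e ∈ out) ∧
    (∀ e, s'.eltLevel e = if e ∈ lowered I A s S ∧ e ∉ rest then l - 1 else v e) ∧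
    Wf I f A {S} s') ?_ ?_) ?_
  · refine ⟨(zero_add _).le, le_rfl, rfl, hd.nodup l, fun _ => id, fun e => ?_,
      h.of_level_update subset_rfl⟩
    rw [if_neg]
    rintro ⟨h₁, h₂⟩
    refine h₂ ((hd.mem_lists l e).2 ?_)
    exact Finset.mem_filter.1 (mem_lowered.1 h₁).1
  · rintro e rest t s' ⟨h₁, h₂, h₃, h₄, h₅, h₆, h₇⟩
    rw [List.nodup_cons] at h₄
    simp only [List.length_cons] at h₁ h₂
    obtain ⟨heE, hel⟩ := hmemout e (h₅ e (by simp))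
    have heA := (mem_elems.1 heE).1
    have hfe := hf e heA
    have hnl := h₇.length_nodelist heA
    simp only [wp_bind, wp_readNodelist]
    set nodes := s'.nodelist e with hnodes
    -- The levels compared with `l` are those after `S` has been lowered, so `S` itself never counts
    -- as a set that keeps the element at level `l`.
    refine wp_mono (wp_foldEach (fun rest a t' s'' => t' + 2 * rest.length = 2 * nodes.length ∧
      s'' = s' ∧ ((a = true ∨ ∃ S' ∈ rest, l ≤ lev S') ↔ ∃ S' ∈ nodes, l ≤ lev S')) ?_ ?_) ?_
    · exact ⟨zero_add _, rfl, by simp⟩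
    · rintro S' rest' a t' s'' ⟨g₁, rfl, g₃⟩
      simp only [wp_bind, wp_readLevel, wp_pure, List.length_cons] at g₁ ⊢
      refine ⟨by omega, trivial, ?_⟩
      rw [← g₃, h₃]
      simp [or_assoc, ← hl]
    · rintro higher t' s'' ⟨g₁, rfl, g₃⟩
      simp only [List.length_nil, mul_zero, add_zero, List.not_mem_nil, false_and, exists_false,
        or_false] at g₁ g₃
      have hlow : higher = false ↔ e ∈ lowered I A s S := by
        rw [← Bool.not_eq_true, g₃, mem_lowered]
        have : e ∈ outSet I A s S := Finset.mem_filter.2 ⟨heE, hel⟩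
        simp only [this, true_and, h₇.mem_nodelist e heA, hnodes, not_exists, not_and, not_le]
        rfl
      rw [wp_ite]
      refine ⟨fun hh => ?_, fun hh => ?_⟩
      · rw [hlow] at hh
        have hvl : s''.eltLevel e = l := by rw [h₆, if_neg (by simp), hel]
        simp only [wp_bind, wp_writeEltLevel]
        have hupd := wp_updateDual (l := l - 1) h₇ heA hfe
        rw [hvl] at hupd
        refine wp_mono hupd ?_
        rintro _ t₃ s₃ ⟨k₁, k₂, k₃, k₄, k₅⟩
        refine ⟨by linarith, by linarith, k₃.trans h₃, h₄.2, fun a ha => h₅ a (by simp [ha]),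
          fun a => ?_, k₂⟩
        rw [k₄]
        rcases eq_or_ne a e with rfl | hae
        · rw [Function.update_self, if_pos ⟨hh, h₄.1⟩]
        · rw [Function.update_of_ne hae, h₆]
          simp [hae]
      · rw [hlow] at hh
        rw [wp_pure]
        refine ⟨by linarith, by linarith, h₃, h₄.2, fun a ha => h₅ a (by simp [ha]),
          fun a => ?_, h₇⟩
        rw [h₆]
        rcases eq_or_ne a e with rfl | hae
        · simp [hh]
        · simp [hae]
  · rintro _ t s' ⟨g₁, g₂, g₃, -, -, g₆, g₇⟩
    simp only [List.length_nil, mul_zero, add_zero, List.not_mem_nil, not_false_eq_true,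
      and_true] at g₁ g₂ g₆
    simp only [wp_readY]
    rw [hlen] at g₁ g₂
    have hne' : (outSet I A s S).Nonempty := by
      rw [← Finset.card_pos, ← hlen]
      exact List.length_pos_of_ne_nil hne
    refine ⟨fun hc => .inr ⟨hne', g₃, g₆, g₇, by omega, g₂, .inl ⟨by trivial, hc⟩⟩,
      fun hc => .inr ⟨hne', g₃, g₆, g₇, by omega, g₂, .inr ⟨by trivial, hc⟩⟩⟩

end

section

variable {U ι : Type}

variable {I : SetSystem U ι} {f : ℕ} {A B : Finset U} {X : Set ι} {s s' : Store U ι} {S : ι} {e : U}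
  {E : Finset U} {v : U → ℤ}

/-! ### The potential of a memory -/

theorem SetSystem.elementLevel_eq_iff [Fintype ι] {level : ι → ℤ} {m : ℤ} : I.elementLevel level e = m ↔
    (∀ S, e ∈ I.family S → level S ≤ m) ∧ ∃ S, e ∈ I.family S ∧ level S = m := by
  have hmem : ∀ S, S ∈ I.setsOf e ↔ e ∈ I.family S := fun S => by simp [setsOf]
  constructor
  · rintro rfl
    refine ⟨fun S hS => Finset.le_sup' level ((hmem S).2 hS), ?_⟩
    obtain ⟨S, hS, h⟩ := Finset.exists_mem_eq_sup' (I.setsOf_nonempty e) level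
    exact ⟨S, (hmem S).1 hS, h.symm⟩
  · rintro ⟨h₁, S, hS, rfl⟩
    exact le_antisymm (Finset.sup'_le _ _ fun S' hS' => h₁ S' ((hmem S').1 hS'))
      (Finset.le_sup' level ((hmem S).2 hS))

/-- All data are correct, the recorded levels of the elements are induced by those of the sets, and
the queue contains all unstable sets that are not in `X`. -/
structure Consistent [Fintype ι] (I : SetSystem U ι) (f : ℕ) (A : Finset U) (X : Set ι) (s : Store U ι) :
    Prop where
  wf : Wf I f A X s
  level_eq : ∀ e ∈ A, s.eltLevel e = I.elementLevel s.level e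
  base_le : ∀ S, I.base f S ≤ s.level S
  freq_le : ∀ e ∈ A, I.freq e ≤ f

theorem Consistent.level_le [Fintype ι] (h : Consistent I f A X s) (he : e ∈ I.elems A S) :
    s.level S ≤ s.eltLevel e := by
  obtain ⟨h₁, h₂⟩ := mem_elems.1 he
  rw [h.level_eq e h₁]
  exact (elementLevel_eq_iff.1 rfl).1 S h₂

/-- At the present level of `S` the cap in φ is inactive, since no element of `S` has a smaller
level. -/
theorem Consistent.scaledDual_eq [Fintype ι] (h : Consistent I f A X s) :
    scaledDual (I.elems A S) s.eltLevel (s.level S) = 2 ^ s.level S * s.ySet S := by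
  rw [DynSetCover.scaledDual_eq fun e he => h.level_le he, (h.wf.data S).dual_eq]

theorem Wf.of_not_unstable (h : Wf I f A {S} s) (hS : ¬ Unstable I f s S) : Wf I f A ∅ s :=
  ⟨h.data, h.nodup_nodelist, h.mem_nodelist, h.nodelist_nil, h.queue.mem_queue, fun S' _ hu =>
    h.queue.inQueue S' (by rintro rfl; exact hS hu) hu⟩

/-- The potential that pays for the downward moves of a set. -/
def downPotential (I : SetSystem U ι) (f : ℕ) (s : Store U ι) (S : ι) : ℝ :=
  if I.base f S < s.level S then
    128 * (2 ^ s.level S * max 0 (beta f * I.cost S / 4 - s.ySet S)) else 0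

theorem downPotential_nonneg : 0 ≤ downPotential I f s S := by
  rw [downPotential]
  split_ifs <;> positivity

/-- An element of `S` contributes at most 2^(-level(S)) to y(S), so after scaling by 2^level(S) the
loss of one element is at most 1; this is why the increase is at most 128 per element. -/
theorem downPotential_le_add {δ : ℝ} (hδ : 0 ≤ δ) (hl : s'.level S = s.level S)
    (hy : 2 ^ s.level S * (s.ySet S - s'.ySet S) ≤ δ) :
    downPotential I f s' S ≤ downPotential I f s S + 128 * δ := by
  rw [downPotential, downPotential, hl]
  split_ifs
  · rw [← mul_add]
    have hp : (0 : ℝ) < 2 ^ s.level S := by positivity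
    have h₁ := mul_le_mul_of_nonneg_left
      (le_max_right 0 (beta f * I.cost S / 4 - s.ySet S)) hp.le
    have h₂ := mul_nonneg hp.le (le_max_left 0 (beta f * I.cost S / 4 - s.ySet S))
    refine mul_le_mul_of_nonneg_left ?_ (by norm_num)
    rw [mul_max_of_nonneg _ _ hp.le]
    refine max_le (by linarith) ?_
    linarith
  · linarith

/-- The potential of a memory. -/
def potential [Fintype ι] (I : SetSystem U ι) (f : ℕ) (A : Finset U) (s : Store U ι) : ℝ :=
  ∑ S, (153 * f * upPotential (I.elems A S) s.eltLevel (beta f * I.cost S) (I.base f S) (s.level S) +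
    downPotential I f s S) + 10 * s.queue.length

theorem potential_nonneg [Fintype ι] : 0 ≤ potential I f A s := by
  refine add_nonneg (Finset.sum_nonneg fun S _ => add_nonneg ?_ downPotential_nonneg)
    (by positivity)
  exact mul_nonneg (by positivity) upPotential_nonneg

/-- Double counting of incidences: it turns bounds on the potential of each set into `f` times the
number of changed elements. -/
theorem sum_card_elems_inter_le [Fintype ι] (hB : ∀ e ∈ B, I.freq e ≤ f) :
    ∑ S, ((I.elems A S ∩ B).card : ℝ) ≤ f * B.card := by
  have h : ∑ S, (I.elems A S ∩ B).card ≤ ∑ e ∈ B, I.freq e := by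
    have h₁ : ∀ S, (I.elems A S ∩ B).card ≤ ∑ e ∈ B, if e ∈ I.family S then 1 else 0 := fun S => by
      rw [← Finset.card_filter]
      refine Finset.card_le_card fun e he => ?_
      rw [Finset.mem_inter, mem_elems] at he
      exact Finset.mem_filter.2 ⟨he.2, he.1.2⟩
    refine (Finset.sum_le_sum fun S _ => h₁ S).trans ?_
    rw [Finset.sum_comm]
    refine Finset.sum_le_sum fun e _ => ?_
    rw [← Finset.card_filter, freq, setsOf]
  have h₂ : ∑ e ∈ B, I.freq e ≤ B.card * f := by
    simpa using Finset.sum_le_card_nsmul B _ f hB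
  have := h.trans h₂
  rw [mul_comm] at this
  exact_mod_cast this

/-- The ceiling in b(S) loses less than a factor 2. The lower bound makes 2^(l-b) dominate l - b in
the potential and makes 2^l M > 1/2 above the base level. -/
theorem SetSystem.quarter_lt_base (hf : 1 ≤ f) :
    1 / 4 < 2 ^ I.base f S * (beta f * I.cost S) := by
  have hM := beta_mul_cost_pos (I := I) (S := S) hf
  set M := beta f * I.cost S with hMdef
  have h₁ := Int.ceil_lt_add_one (Real.logb 2 M)
  have h₂ : (2 : ℝ) ^ (-(I.base f S + 2)) < M := by
    rw [← Real.rpow_intCast]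
    refine (Real.lt_logb_iff_rpow_lt (by norm_num) hM).1 ?_
    rw [base, ← hMdef]
    push_cast
    linarith
  have h₃ : (2 : ℝ) ^ (I.base f S + 2) * 2 ^ (-(I.base f S + 2)) = 1 := by
    rw [← zpow_add₀ (by norm_num)]; simp
  have h₄ : (2 : ℝ) ^ (I.base f S + 2) = 2 ^ I.base f S * 4 := by
    rw [zpow_add₀ (by norm_num)]; norm_num
  have h₅ := mul_lt_mul_of_pos_left h₂ (show (0 : ℝ) < 2 ^ (I.base f S + 2) by positivity)
  rw [h₃, h₄] at h₅
  linarith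

/-- The final -1 in the definition of b(S) gives 1/2, strictly below 1, which is what feasibility
needs. -/
theorem SetSystem.base_mul_le_half (hf : 1 ≤ f) :
    2 ^ I.base f S * (beta f * I.cost S) ≤ 1 / 2 := by
  have hM := beta_mul_cost_pos (I := I) (S := S) hf
  set M := beta f * I.cost S with hMdef
  have h₁ := Int.le_ceil (Real.logb 2 M)
  have h₂ : M ≤ (2 : ℝ) ^ (-(I.base f S + 1)) := by
    rw [← Real.rpow_intCast]
    refine (Real.logb_le_iff_le_rpow (by norm_num) hM).1 ?_
    rw [base, ← hMdef]
    push_cast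
    linarith
  have h₃ : (2 : ℝ) ^ I.base f S * 2 ^ (-(I.base f S + 1)) = 1 / 2 := by
    rw [← zpow_add₀ (by norm_num)]; simp
  rw [← h₃]
  gcongr

/-- The amortized cost of an upward move. -/
theorem wp_moveUp_amortized [Fintype ι] (h : Consistent I f A {S} s) (hf1 : 1 ≤ f)
    (hy : beta f * I.cost S < s.ySet S) :
    wp (moveUp I f S) s fun _ t s' => Consistent I f A ∅ s' ∧
      t + potential I f A s' ≤ potential I f A s + 3 := by
  refine wp_mono (wp_moveUp h.wf hf1 h.freq_le (fun e he => h.level_le he) hy) ?_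
  rintro _ t s' ⟨l', hll', hbefore, hafter, hlev, helt, hwf, ht, hq⟩
  set B := below (I.elems A S) s.eltLevel l' with hB
  have hmemB : ∀ e, e ∈ B ↔ e ∈ I.elems A S ∧ s.eltLevel e ≤ l' := fun e => Finset.mem_filter
  have hBf : ∀ e ∈ B, I.freq e ≤ f := fun e he =>
    h.freq_le e (mem_elems.1 ((hmemB e).1 he).1).1
  have hM := beta_mul_cost_pos (I := I) (S := S) hf1
  have hmono : ∀ e, s.eltLevel e ≤ s'.eltLevel e := fun e => by
    rw [helt]; split_ifs with hc; exacts [hc.2, le_rfl]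
  have hmax : ∀ e ∈ I.elems A S, s'.eltLevel e = max l' (s.eltLevel e) := fun e he => by
    rw [helt]
    split_ifs with hc
    · rw [max_eq_left hc.2]
    · rw [max_eq_right]
      by_contra hlt
      exact hc ⟨he, by omega⟩
  have hS := upPotential_up (quarter_lt_base hf1) (h.base_le S) hll' hbefore hafter hmax
  have hcons : Consistent I f A ∅ s' := by
    refine ⟨hwf, fun e he => ?_, fun S' => ?_, h.freq_le⟩
    · symm
      rw [elementLevel_eq_iff, hlev, helt]
      obtain ⟨h₁, S₁, h₂, h₃⟩ := elementLevel_eq_iff.1 (h.level_eq e he).symm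
      split_ifs with hc
      · refine ⟨fun S' hS' => ?_, S, (mem_elems.1 hc.1).2, Function.update_self _ _ _⟩
        rcases eq_or_ne S' S with rfl | hne
        · rw [Function.update_self]
        · rw [Function.update_of_ne hne]; exact (h₁ S' hS').trans hc.2
      · have hc' : e ∈ I.family S → l' < s.eltLevel e := fun heS => by
          by_contra hlt
          exact hc ⟨mem_elems.2 ⟨he, heS⟩, by omega⟩
        refine ⟨fun S' hS' => ?_, S₁, h₂, ?_⟩
        · rcases eq_or_ne S' S with rfl | hne
          · rw [Function.update_self]; exact (hc' hS').le
          · rw [Function.update_of_ne hne]; exact h₁ S' hS'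
        · rw [Function.update_of_ne _, h₃]
          rintro rfl
          have := hc' h₂
          omega
    · rw [hlev]
      rcases eq_or_ne S' S with rfl | hne
      · rw [Function.update_self]; exact (h.base_le S').trans hll'.le
      · rw [Function.update_of_ne hne]; exact h.base_le S'
  refine ⟨hcons, ?_⟩
  -- Raising elements cannot increase any other up-potential; it costs at most 128 in the
  -- down-potential for each raised element of a set. The set `S` itself releases 153 f (N + l' -
  -- l).
  have key : ∀ S', 153 * f * upPotential (I.elems A S') s'.eltLevel (beta f * I.cost S')
        (I.base f S') (s'.level S') + downPotential I f s' S' ≤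
      153 * f * upPotential (I.elems A S') s.eltLevel (beta f * I.cost S')
        (I.base f S') (s.level S') + downPotential I f s S' + 128 * (I.elems A S' ∩ B).card -
        if S' = S then 153 * f * (B.card + (l' - s.level S : ℝ)) else 0 := by
    intro S'
    split_ifs with hS'
    · subst hS'
      have hl' : s'.level S' = l' := by rw [hlev, Function.update_self]
      have hdown : downPotential I f s' S' = 0 := by
        have hz : scaledDual (I.elems A S') s.eltLevel l' = 2 ^ l' * s'.ySet S' := by
          rw [← hl', ← hcons.scaledDual_eq, hl', scaledDual_congr_of_max hmax le_rfl]
        have hz' := scaledDual_succ (E := I.elems A S') (v := s.eltLevel) (j := l' - 1)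
        have hN := card_below_le_scaledDual (E := I.elems A S') (v := s.eltLevel) (j := l' - 1)
        have hpow : (2 : ℝ) ^ l' = 2 * 2 ^ (l' - 1) := by
          rw [← zpow_one_add₀ (by norm_num)]; congr 1; ring
        rw [sub_add_cancel] at hz'
        have hp : (0 : ℝ) < 2 ^ (l' - 1) := by positivity
        have h₁ : 2 ^ (l' - 1) * (beta f * I.cost S') < 2 ^ (l' - 1) * (2 * s'.ySet S') := by
          rw [hpow] at hz
          linarith
        have h₂ := lt_of_mul_lt_mul_left h₁ hp.le
        rw [downPotential, max_eq_left (by linarith)]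
        simp
      rw [hdown, hl']
      have h₁ := mul_le_mul_of_nonneg_left hS (show (0 : ℝ) ≤ 153 * f by positivity)
      have h₂ := downPotential_nonneg (I := I) (f := f) (s := s) (S := S')
      have h₃ : (0 : ℝ) ≤ (I.elems A S' ∩ B).card := Nat.cast_nonneg _
      linarith
    · have hl' : s'.level S' = s.level S' := by rw [hlev, Function.update_of_ne hS']
      have hup := upPotential_le_add (E := I.elems A S') (E' := I.elems A S') (v := s.eltLevel)
        (v' := s'.eltLevel) (l := s.level S') (b := I.base f S')
        (beta_mul_cost_pos (I := I) (S := S') hf1).le le_rfl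
        fun j _ => by rw [add_zero]; exact scaledDual_anti fun e _ => hmono e
      rw [mul_zero, add_zero] at hup
      have hdown : downPotential I f s' S' ≤
          downPotential I f s S' + 128 * (I.elems A S' ∩ B).card := by
        refine downPotential_le_add (by positivity) hl' ?_
        rw [(h.wf.data S').dual_eq, (hwf.data S').dual_eq, ← Finset.sum_sub_distrib,
          Finset.mul_sum, ← Finset.filter_mem_eq_inter, Finset.card_filter, Nat.cast_sum]
        refine Finset.sum_le_sum fun e he => ?_
        split_ifs with heB
        · have h₁ : (2 : ℝ) ^ s.level S' * dual (s.eltLevel e) ≤ 1 := by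
            rw [dual, ← zpow_add₀ (by norm_num)]
            refine zpow_le_one_of_nonpos₀ (by norm_num) ?_
            have := h.level_le he
            omega
          have h₂ := mul_pos (show (0 : ℝ) < 2 ^ s.level S' by positivity)
            (dual_pos (s'.eltLevel e))
          rw [mul_sub, Nat.cast_one]
          linarith
        · rw [helt, if_neg fun hc => heB ((hmemB e).2 hc)]
          simp
      rw [hl']
      have h₁ := mul_le_mul_of_nonneg_left hup (show (0 : ℝ) ≤ 153 * f by positivity)
      linarith
  have hsum := Finset.sum_le_sum fun S' (_ : S' ∈ Finset.univ) => key S'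
  rw [Finset.sum_sub_distrib, Finset.sum_add_distrib (g := fun S' => 128 * _),
    Finset.sum_ite_eq' Finset.univ S, if_pos (Finset.mem_univ _), ← Finset.mul_sum] at hsum
  have hcount := sum_card_elems_inter_le (A := A) hBf
  have hf1' : (1 : ℝ) ≤ f := by exact_mod_cast hf1
  have hgap : (1 : ℝ) ≤ l' - s.level S := by
    have : s.level S + 1 ≤ l' := hll'
    have : (s.level S : ℝ) + 1 ≤ l' := by exact_mod_cast this
    linarith
  have ht' : (t : ℝ) ≤ 3 + 3 * (l' - s.level S) + (6 + 8 * f) * B.card := by exact_mod_cast ht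
  have hq' : (s'.queue.length : ℝ) ≤ s.queue.length + f * B.card := by exact_mod_cast hq
  have hNf : (B.card : ℝ) ≤ f * B.card := le_mul_of_one_le_left (by positivity) hf1'
  have hgf : (l' - s.level S : ℝ) ≤ f * (l' - s.level S) :=
    le_mul_of_one_le_left (by linarith) hf1'
  -- The weight 153 covers, per raised element, 6 + 8 f steps, 10 f for new queue entries and 128 f
  -- for the down-potentials: together at most 152 f. The release per level pays for the three steps
  -- of the inner loop.
  rw [potential, potential]
  linarith

end

section

variable {U ι : Type} [Fintype ι]

variable {I : SetSystem U ι} {f : ℕ} {A B : Finset U} {X : Set ι} {s s' : Store U ι} {S : ι} {e : U}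
  {E : Finset U} {v : U → ℤ}

/-! ### The amortized cost of downward moves -/

/-- No active element has its maximum at `S` alone or jointly with others, so no level of an element
and no dual value changes. At the base level both potentials of `S` vanish because y(S) < M/2. -/
theorem Consistent.jump_to_base (h : Consistent I f A {S} s) (hf1 : 1 ≤ f)
    (hy : s.ySet S < I.cost S / beta f) (hout : outSet I A s S = ∅) :
    Consistent I f A ∅ { s with level := Function.update s.level S (I.base f S) } ∧
      potential I f A { s with level := Function.update s.level S (I.base f S) } ≤
        potential I f A s := by
  set s' : Store U ι := { s with level := Function.update s.level S (I.base f S) } with hs'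
  have hM := beta_mul_cost_pos (I := I) (S := S) hf1
  have hyM := hy.trans_le (cost_div_beta_le' hf1)
  have hself : s'.level S = I.base f S := by simp [hs']
  have hother : ∀ S' ≠ S, s'.level S' = s.level S' := fun S' hS' => by simp [hs', hS']
  have hcons : Consistent I f A ∅ s' := by
    refine ⟨(h.wf.of_level_update subset_rfl).of_not_unstable ?_, fun e he => ?_, fun S' => ?_,
      h.freq_le⟩
    · rintro (hu | ⟨-, hu⟩)
      · exact absurd hu (not_lt.2 (by simp only; linarith))
      · exact absurd hself hu.ne'
    · symm
      rw [elementLevel_eq_iff]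
      obtain ⟨h₁, S₁, h₂, h₃⟩ := elementLevel_eq_iff.1 (h.level_eq e he).symm
      refine ⟨fun S' hS' => ?_, S₁, h₂, ?_⟩
      · rcases eq_or_ne S' S with rfl | hne
        · rw [hself]; exact (h.base_le S').trans (h₁ S' hS')
        · rw [hother S' hne]; exact h₁ S' hS'
      · rw [hother, h₃]
        rintro rfl
        have : e ∈ outSet I A s S₁ := Finset.mem_filter.2 ⟨mem_elems.2 ⟨he, h₂⟩, h₃.symm⟩
        simp [hout] at this
    · rcases eq_or_ne S' S with rfl | hne
      · rw [hself]
      · rw [hother S' hne]; exact h.base_le S'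
  refine ⟨hcons, add_le_add (Finset.sum_le_sum fun S' _ => ?_) le_rfl⟩
  rcases eq_or_ne S' S with rfl | hne
  · rw [hself, upPotential_eq_zero le_rfl]
    · have hd : downPotential I f s' S' = 0 := by rw [downPotential, if_neg (by rw [hself]; simp)]
      rw [hd, mul_zero, add_zero]
      exact add_nonneg (mul_nonneg (by positivity) upPotential_nonneg) downPotential_nonneg
    · have := hcons.scaledDual_eq (S := S')
      rw [hself] at this
      rw [this, mul_div_assoc]
      gcongr
      change s.ySet S' ≤ _
      linarith
  · rw [hother S' hne]
    refine add_le_add le_rfl (le_of_eq ?_)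
    rw [downPotential, downPotential, hother S' hne]

/-- The invariants after a downward move by one level. -/
theorem Consistent.of_lowered {Y : Set ι} (h : Consistent I f A {S} s)
    (hbase : I.base f S < s.level S)
    (hlev : s'.level = Function.update s.level S (s.level S - 1))
    (helt : ∀ e, s'.eltLevel e = if e ∈ lowered I A s S then s.level S - 1 else s.eltLevel e)
    (hwf : Wf I f A Y s') : Consistent I f A Y s' := by
  have hself : s'.level S = s.level S - 1 := by rw [hlev, Function.update_self]
  have hother : ∀ S' ≠ S, s'.level S' = s.level S' := fun S' hS' => by
    rw [hlev, Function.update_of_ne hS']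
  refine ⟨hwf, fun e he => ?_, fun S' => ?_, h.freq_le⟩
  · symm
    rw [elementLevel_eq_iff, helt]
    obtain ⟨h₁, S₁, h₂, h₃⟩ := elementLevel_eq_iff.1 (h.level_eq e he).symm
    split_ifs with hc
    · obtain ⟨hc₁, hc₂⟩ := mem_lowered.1 hc
      obtain ⟨hc₃, -⟩ := Finset.mem_filter.1 hc₁
      refine ⟨fun S' hS' => ?_, S, (mem_elems.1 hc₃).2, hself⟩
      have := hc₂ S' hS'
      rw [hlev]
      omega
    · refine ⟨fun S' hS' => ?_, ?_⟩
      · rcases eq_or_ne S' S with rfl | hne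
        · rw [hself]; have := h₁ S' hS'; omega
        · rw [hother S' hne]; exact h₁ S' hS'
      · rcases eq_or_ne S₁ S with rfl | hne
        · have ho : e ∈ outSet I A s S₁ := Finset.mem_filter.2 ⟨mem_elems.2 ⟨he, h₂⟩, h₃.symm⟩
          rw [mem_lowered] at hc
          simp only [ho, true_and, not_forall, not_lt] at hc
          obtain ⟨S', hS', hle⟩ := hc
          refine ⟨S', hS', le_antisymm ?_ ?_⟩
          · rcases eq_or_ne S' S₁ with rfl | hne
            · rw [hself]; have := h₁ S' hS'; omega
            · rw [hother S' hne]; exact h₁ S' hS'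
          · rw [hlev, ← h₃]; exact hle
        · exact ⟨S₁, h₂, by rw [hother S₁ hne, h₃]⟩
  · rcases eq_or_ne S' S with rfl | hne
    · rw [hself]; omega
    · rw [hother S' hne]; exact h.base_le S'

/-- The change of the potential in a downward move by one level. -/
theorem Consistent.potential_lowered (h : Consistent I f A {S} s) (h' : Consistent I f A X s')
    (hf1 : 1 ≤ f) (hbase : I.base f S < s.level S) (hy : s.ySet S < I.cost S / beta f)
    (hlev : s'.level = Function.update s.level S (s.level S - 1))
    (helt : ∀ e, s'.eltLevel e = if e ∈ lowered I A s S then s.level S - 1 else s.eltLevel e)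
    (hq : s'.queue.length ≤ s.queue.length + f * (outSet I A s S).card) :
    s'.ySet S ≤ beta f * I.cost S / 512 ∧
    potential I f A s' + 5 + (4 + 10 * f) * (outSet I A s S).card ≤ potential I f A s := by
  have hself : s'.level S = s.level S - 1 := by rw [hlev, Function.update_self]
  have hother : ∀ S' ≠ S, s'.level S' = s.level S' := fun S' hS' => by
    rw [hlev, Function.update_of_ne hS']
  set M := beta f * I.cost S with hMdef
  have hM : 0 < M := beta_mul_cost_pos hf1
  set l := s.level S with hl
  have hf1' : (1 : ℝ) ≤ f := by exact_mod_cast hf1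
  have hlow_out : lowered I A s S ⊆ outSet I A s S := fun e he => (mem_lowered.1 he).1
  have hlowf : ∀ e ∈ lowered I A s S, I.freq e ≤ f := fun e he =>
    h.freq_le e (mem_elems.1 (Finset.mem_filter.1 (hlow_out he)).1).1
  have hlowl : ∀ e ∈ lowered I A s S, s.eltLevel e = l := fun e he =>
    (Finset.mem_filter.1 (hlow_out he)).2
  have hle : ∀ e, dual (s.eltLevel e) ≤ dual (s'.eltLevel e) := fun e => by
    rw [helt]
    split_ifs with hc
    · rw [hlowl e hc, dual, dual]
      exact zpow_le_zpow_right₀ (by norm_num) (by omega)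
    · exact le_rfl
  have hle2 : ∀ e, dual (s'.eltLevel e) ≤ 2 * dual (s.eltLevel e) := fun e => by
    rw [helt]
    have := dual_pos (s.eltLevel e)
    split_ifs with hc
    · have h₁ := dual_add_one (l - 1)
      rw [sub_add_cancel] at h₁
      rw [hlowl e hc, h₁]
      linarith
    · linarith
  have hymono : ∀ S', s.ySet S' ≤ s'.ySet S' := fun S' => by
    rw [(h.wf.data S').dual_eq, (h'.wf.data S').dual_eq]
    exact Finset.sum_le_sum fun e _ => hle e
  have hy2 : s'.ySet S ≤ 2 * s.ySet S := by
    rw [(h.wf.data S).dual_eq, (h'.wf.data S).dual_eq, Finset.mul_sum]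
    exact Finset.sum_le_sum fun e _ => hle2 e
  have hyM : s.ySet S < M / 1024 := hy.trans_le (cost_div_beta_le' hf1)
  refine ⟨by linarith, ?_⟩
  -- the number of elements at the level of `S` is small
  have hW : 1 / 2 < 2 ^ l * M := by
    have h₁ := quarter_lt_base (I := I) (S := S) hf1
    have h₂ : (2 : ℝ) ^ (I.base f S + 1) ≤ 2 ^ l :=
      zpow_le_zpow_right₀ (by norm_num) (by omega)
    rw [zpow_add_one₀ (by norm_num)] at h₂
    have := mul_le_mul_of_nonneg_right h₂ hM.le
    linarith
  -- Each element at level `l` contributes 2^(-l) to y(S), and y(S) < c_S / β = M / (1024 f²).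
  have hn : 1024 * f ^ 2 * ((outSet I A s S).card : ℝ) ≤ 2 ^ l * M := by
    have h₁ : ((outSet I A s S).card : ℝ) * dual l ≤ s.ySet S := by
      rw [(h.wf.data S).dual_eq, ← nsmul_eq_mul, ← Finset.sum_const]
      rw [Finset.sum_congr rfl (g := fun e => dual (s.eltLevel e)) fun e he => by
        rw [(Finset.mem_filter.1 he).2]]
      exact Finset.sum_le_sum_of_subset_of_nonneg (Finset.filter_subset _ _)
        fun e _ _ => (dual_pos _).le
    have h₂ : ((outSet I A s S).card : ℝ) * dual l ≤ M / (1024 * f ^ 2) :=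
      h₁.trans (hy.le.trans (cost_div_beta_le hf1))
    rw [le_div_iff₀ (by positivity)] at h₂
    have h₃ := mul_le_mul_of_nonneg_left h₂ (show (0 : ℝ) ≤ 2 ^ l by positivity)
    calc 1024 * f ^ 2 * ((outSet I A s S).card : ℝ)
        = 1024 * f ^ 2 * ((outSet I A s S).card : ℝ) * (2 ^ l * dual l) := by
          rw [zpow_mul_dual, mul_one]
      _ = 2 ^ l * (((outSet I A s S).card : ℝ) * dual l * (1024 * f ^ 2)) := by ring
      _ ≤ _ := h₃
  set n : ℝ := ((outSet I A s S).card : ℝ) with hndef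
  -- For `S` the down-potential drops from 128 to at most 64 times 2^l (M/4 - y(S)), a release of at
  -- least (16 - 1/16) 2^l M. For the other sets dual values only grow, so only the up-potential can
  -- increase, by 21 per lowered element.
  have key : ∀ S', 153 * f * upPotential (I.elems A S') s'.eltLevel (beta f * I.cost S')
        (I.base f S') (s'.level S') + downPotential I f s' S' ≤
      153 * f * upPotential (I.elems A S') s.eltLevel (beta f * I.cost S')
        (I.base f S') (s.level S') + downPotential I f s S' +
          153 * f * 21 * (I.elems A S' ∩ lowered I A s S).card -
        if S' = S then 15 * (2 ^ l * M) else 0 := by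
    intro S'
    split_ifs with hS'
    · subst hS'
      have hup : upPotential (I.elems A S') s'.eltLevel M (I.base f S') (s'.level S') = 0 := by
        refine upPotential_eq_zero (h'.base_le S') ?_
        rw [h'.scaledDual_eq, mul_div_assoc]
        gcongr
        linarith
      have h₁ : downPotential I f s S' = 128 * (2 ^ l * (M / 4 - s.ySet S')) := by
        rw [downPotential, if_pos hbase, max_eq_right (by linarith)]
      have h₂ : downPotential I f s' S' ≤ 64 * (2 ^ l * (M / 4 - s.ySet S')) := by
        rw [downPotential]
        split_ifs
        · have hy' : max 0 (M / 4 - s'.ySet S') ≤ M / 4 - s.ySet S' :=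
            max_le (by linarith) (by linarith [hymono S'])
          rw [hself, zpow_sub_one₀ (by norm_num)]
          have := mul_le_mul_of_nonneg_left hy' (show (0 : ℝ) ≤ 2 ^ l by positivity)
          linarith
        · have : 0 ≤ M / 4 - s.ySet S' := by linarith
          positivity
      have h₃ : 2 ^ l * s.ySet S' ≤ 2 ^ l * (M / 1024) := by gcongr
      have h₄ : (0 : ℝ) ≤ 153 * f * 21 * (I.elems A S' ∩ lowered I A s S').card := by positivity
      have h₅ : 0 ≤ 153 * f * upPotential (I.elems A S') s.eltLevel M (I.base f S') l :=
        mul_nonneg (by positivity) upPotential_nonneg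
      have h₆ : 0 < 2 ^ l * M := by positivity
      rw [hup, mul_zero, zero_add, h₁]
      linarith
    · rw [hother S' hS']
      have hup := upPotential_le_add (E := I.elems A S') (E' := I.elems A S') (v := s.eltLevel)
        (v' := s'.eltLevel) (l := s.level S') (b := I.base f S')
        (beta_mul_cost_pos (I := I) (S := S') hf1).le (Nat.cast_nonneg _)
        fun j _ => scaledDual_le_add_card (F := lowered I A s S) fun e _ he => by
          rw [helt, if_neg he]
      have hdown := downPotential_le_add (I := I) (f := f) (S := S') le_rfl (hother S' hS')
        (mul_nonpos_of_nonneg_of_nonpos (by positivity) (sub_nonpos.2 (hymono S')))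
      have h₁ := mul_le_mul_of_nonneg_left hup (show (0 : ℝ) ≤ 153 * f by positivity)
      linarith
  have hsum := Finset.sum_le_sum fun S' (_ : S' ∈ Finset.univ) => key S'
  rw [Finset.sum_sub_distrib, Finset.sum_add_distrib (g := fun S' => 153 * (f : ℝ) * 21 * _),
    Finset.sum_ite_eq' Finset.univ S, if_pos (Finset.mem_univ _), ← Finset.mul_sum] at hsum
  have hcount := sum_card_elems_inter_le (A := A) hlowf
  have hlown : ((lowered I A s S).card : ℝ) ≤ n := by
    rw [hndef]
    exact_mod_cast Finset.card_le_card hlow_out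
  have hcount' : 153 * (f : ℝ) * 21 * ∑ S', ((I.elems A S' ∩ lowered I A s S).card : ℝ) ≤
      3213 * (f ^ 2 * n) := by
    calc _ ≤ 153 * (f : ℝ) * 21 * (f * (lowered I A s S).card) := by gcongr
      _ ≤ 153 * (f : ℝ) * 21 * (f * n) := by gcongr
      _ = _ := by ring
  have hq' : (s'.queue.length : ℝ) ≤ s.queue.length + f * n := by
    rw [hndef]
    exact_mod_cast hq
  have hn0 : 0 ≤ n := Nat.cast_nonneg _
  have hfn : f * n ≤ f ^ 2 * n := by gcongr; nlinarith
  have hnf : n ≤ f * n := le_mul_of_one_le_left hn0 hf1'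
  -- The charges are at most (3213 + 14 + 10) f² n + 5. As 1024 f² n ≤ 2^l M and 2^l M > 1/2, they
  -- stay below 15 · 2^l M.
  rw [potential, potential]
  linarith

/-- Every step down by one level pays for itself and for its loop iteration. The 4 extra steps are
needed only when the loop ends with a jump to the base level. -/
theorem wp_moveDown_amortized (h : Consistent I f A {S} s) (hf1 : 1 ≤ f)
    (hy : s.ySet S < I.cost S / beta f) (hbase : I.base f S < s.level S) :
    wp (moveDown I f S) s fun _ t s' => Consistent I f A ∅ s' ∧
      t + potential I f A s' ≤ potential I f A s + 4 := by
  refine wp_loop (fun n _ t s' => n = (s'.level S - I.base f S).toNat ∧ Consistent I f A {S} s' ∧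
    s'.ySet S < I.cost S / beta f ∧ I.base f S < s'.level S ∧
    t + potential I f A s' ≤ potential I f A s) (n := (s.level S - I.base f S).toNat)
    ⟨rfl, h, hy, hbase, by simp⟩ ?_
  rintro n _ t s₁ ⟨hn, h₁, hy₁, hbase₁, ht⟩
  refine wp_mono (wp_downStep h₁.wf h₁.freq_le) ?_
  rintro r t' s₂ (⟨hout, rfl, rfl, rfl⟩ | ⟨-, hlev, helt, hwf, ht', hq, hr⟩)
  · obtain ⟨h₂, hpot⟩ := h₁.jump_to_base hf1 hy₁ hout
    refine ⟨fun _ _ => ⟨h₂, ?_⟩, by simp⟩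
    push_cast
    linarith
  · have h₂ := h₁.of_lowered hbase₁ hlev helt hwf
    obtain ⟨hy₂, hpot⟩ := h₁.potential_lowered h₂ hf1 hbase₁ hy₁ hlev helt hq
    have ht₂ : (t' : ℝ) ≤ 4 + (4 + 10 * f) * (outSet I A s₁ S).card := by exact_mod_cast ht'
    have hself : s₂.level S = s₁.level S - 1 := by rw [hlev, Function.update_self]
    rcases hr with ⟨rfl, hc₁, hc₂⟩ | ⟨rfl, hc⟩
    · refine ⟨by simp, fun _ _ => ⟨_, ?_, rfl, h₂, hc₁, by omega, ?_⟩⟩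
      · omega
      · push_cast
        linarith
    · refine ⟨fun _ _ => ⟨⟨hwf.of_not_unstable ?_, h₂.level_eq, h₂.base_le, h₂.freq_le⟩, ?_⟩,
        by simp⟩
      · have := beta_mul_cost_pos (I := I) (S := S) hf1
        rintro (hu | hu)
        · linarith
        · rw [hself] at hu
          exact hc hu
      · push_cast
        linarith

/-! ### Stabilization -/

theorem Consistent.potential_congr {q : List ι} {b : ι → Bool} :
    potential I f A { s with queue := q, inQueue := b } =
      potential I f A s - 10 * s.queue.length + 10 * q.length := by
  simp only [potential, downPotential]
  ring

/-- The 10 units of the removed queue entry cover three operations, at most 4 unpaid steps of the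
move, the loop step, and one unit of strict decrease that yields termination. -/
theorem wp_stabilizeStep_amortized (h : Consistent I f A ∅ s) (hf1 : 1 ≤ f) :
    wp (stabilizeStep I f) s fun r t s' => Consistent I f A ∅ s' ∧
      (r = .inl () ∧ s'.queue = [] ∧ t = 1 ∧ s' = s ∨
        r = .inr () ∧ t + 1 + potential I f A s' + 1 ≤ potential I f A s) := by
  rw [stabilizeStep, wp_bind, dequeue, wp_step]
  rcases hQ : s.queue with _ | ⟨S, Q⟩
  · simp only [wp_pure]
    exact ⟨h, .inl ⟨trivial, hQ, trivial, trivial⟩⟩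
  · have h₁ : Consistent I f A {S}
        { s with queue := Q, inQueue := Function.update s.inQueue S false } := by
      refine ⟨⟨fun S' => (h.wf.data S').of_agree rfl rfl fun _ _ => rfl, h.wf.nodup_nodelist,
        h.wf.mem_nodelist, h.wf.nodelist_nil, fun S' hS' => ?_, fun S' hS' hu => ?_⟩, h.level_eq,
        h.base_le, h.freq_le⟩
      · rcases eq_or_ne S' S with rfl | hne
        · simp at hS'
        · simp only [Function.update_of_ne hne] at hS'
          have := h.wf.queue.mem_queue S' hS'
          rw [hQ] at this
          exact (List.mem_cons.1 this).resolve_left hne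
      · have hne : S' ≠ S := hS'
        simp only [Function.update_of_ne hne]
        exact h.wf.queue.inQueue S' (Set.notMem_empty _) hu
    have hpot := Consistent.potential_congr (I := I) (f := f) (A := A) (s := s) (q := Q)
      (b := Function.update s.inQueue S false)
    set s₁ : Store U ι := { s with queue := Q, inQueue := Function.update s.inQueue S false }
    rw [hQ, List.length_cons] at hpot
    push_cast at hpot
    simp only [wp_bind, wp_readY, wp_readLevel, wp_ite, wp_pure]
    refine ⟨fun hy => wp_mono (wp_moveUp_amortized h₁ hf1 hy) ?_, fun hy => ⟨fun hy' =>
      wp_mono (wp_moveDown_amortized h₁ hf1 hy'.1 hy'.2) ?_, fun hy' => ?_⟩⟩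
    · rintro _ t s₂ ⟨h₂, ht⟩
      refine ⟨h₂, .inr ⟨trivial, ?_⟩⟩
      push_cast
      linarith
    · rintro _ t s₂ ⟨h₂, ht⟩
      refine ⟨h₂, .inr ⟨trivial, ?_⟩⟩
      push_cast
      linarith
    · refine ⟨⟨h₁.wf.of_not_unstable ?_, h₁.level_eq, h₁.base_le, h₁.freq_le⟩, .inr ⟨trivial, ?_⟩⟩
      · rintro (hu | hu)
        exacts [hy hu, hy' hu]
      · push_cast
        linarith

/-- The amortized cost of the stabilization. -/
theorem wp_stabilize_amortized (h : Consistent I f A ∅ s) (hf1 : 1 ≤ f) :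
    wp (stabilize I f) s fun _ t s' => Consistent I f A ∅ s' ∧ s'.queue = [] ∧
      t + potential I f A s' ≤ potential I f A s + 2 := by
  -- The potential is real and nonnegative and falls by at least 1 per iteration, so its integer
  -- part is a variant.
  refine wp_loop (fun n _ t s' => n = ⌊potential I f A s'⌋₊ ∧ Consistent I f A ∅ s' ∧
    t + potential I f A s' ≤ potential I f A s) (n := ⌊potential I f A s⌋₊)
    ⟨rfl, h, by simp⟩ ?_
  rintro n _ t s₁ ⟨rfl, h₁, ht⟩
  refine wp_mono (wp_stabilizeStep_amortized h₁ hf1) ?_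
  rintro r t' s₂ ⟨h₂, ⟨rfl, hq, rfl, rfl⟩ | ⟨rfl, ht'⟩⟩
  · refine ⟨fun _ _ => ⟨h₂, hq, ?_⟩, by simp⟩
    push_cast
    linarith
  · refine ⟨by simp, fun _ _ => ⟨_, ?_, rfl, h₂, ?_⟩⟩
    · have h₃ := potential_nonneg (I := I) (f := f) (A := A) (s := s₂)
      have h₄ : (0 : ℝ) ≤ t' := Nat.cast_nonneg _
      rw [← Nat.add_one_le_iff, Nat.le_floor_iff (by linarith)]
      push_cast
      have := Nat.floor_le h₃
      linarith
    · push_cast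
      linarith

end

section

variable {U ι : Type} [Fintype ι]

variable {I : SetSystem U ι} {f : ℕ} {A B : Finset U} {X : Set ι} {s s' : Store U ι} {S : ι} {e : U}
  {E : Finset U} {v : U → ℤ}

/-! ### Arrivals and departures -/

theorem sum_ite_mem_family (I : SetSystem U ι) (e : U) (x : ℝ) :
    ∑ S, (if e ∈ I.family S then x else 0) = I.freq e * x := by
  rw [← Finset.sum_filter, Finset.sum_const, nsmul_eq_mul, freq, setsOf]

/-- The change of the potential when the element `e` becomes active. -/
theorem potential_insert_le (h : Wf I f A X s) (h' : Wf I f (insert e A) X s') (hf1 : 1 ≤ f)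
    (hf : I.freq e ≤ f) (hlev : s'.level = s.level)
    (helt : ∀ a ∈ A, s'.eltLevel a = s.eltLevel a) (hq : s'.queue.length ≤ s.queue.length + f) :
    potential I f (insert e A) s' ≤ potential I f A s + 3213 * f ^ 2 + 10 * f := by
  have helems : ∀ S, ∀ a ∈ I.elems A S, s'.eltLevel a = s.eltLevel a := fun S a ha =>
    helt a (mem_elems.1 ha).1
  have key : ∀ S, 153 * f * upPotential (I.elems (insert e A) S) s'.eltLevel (beta f * I.cost S)
        (I.base f S) (s'.level S) + downPotential I f s' S ≤
      153 * f * upPotential (I.elems A S) s.eltLevel (beta f * I.cost S)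
        (I.base f S) (s.level S) + downPotential I f s S +
        if e ∈ I.family S then 3213 * (f : ℝ) else 0 := by
    intro S
    have hM := (beta_mul_cost_pos (I := I) (S := S) hf1).le
    have hz : ∀ j, scaledDual (I.elems A S) s'.eltLevel j = scaledDual (I.elems A S) s.eltLevel j :=
      fun j => scaledDual_congr (helems S)
    have hup : upPotential (I.elems (insert e A) S) s'.eltLevel (beta f * I.cost S)
        (I.base f S) (s'.level S) ≤ upPotential (I.elems A S) s.eltLevel (beta f * I.cost S)
        (I.base f S) (s.level S) + 21 * if e ∈ I.family S then 1 else 0 := by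
      rw [hlev]
      refine upPotential_le_add hM (by split_ifs <;> norm_num) fun j _ => ?_
      rw [← hz]
      split_ifs with heS
      · rw [elems_insert_of_mem heS]; exact scaledDual_insert_le
      · rw [elems_insert_of_notMem heS, add_zero]
    have hy : s.ySet S ≤ s'.ySet S := by
      rw [(h.data S).dual_eq, (h'.data S).dual_eq,
        Finset.sum_congr rfl fun a ha => by rw [← helems S a ha]]
      refine Finset.sum_le_sum_of_subset_of_nonneg ?_ fun _ _ _ => (dual_pos _).le
      exact Finset.filter_subset_filter _ (Finset.subset_insert _ _)
    have hdown := downPotential_le_add (I := I) (f := f) (S := S) le_rfl (congrFun hlev S)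
      (mul_nonpos_of_nonneg_of_nonpos (by positivity) (sub_nonpos.2 hy))
    have h₁ := mul_le_mul_of_nonneg_left hup (show (0 : ℝ) ≤ 153 * f by positivity)
    split_ifs at h₁ ⊢ <;> linarith
  have hsum := Finset.sum_le_sum fun S (_ : S ∈ Finset.univ) => key S
  rw [Finset.sum_add_distrib (g := fun S => if e ∈ I.family S then _ else _),
    sum_ite_mem_family] at hsum
  have hf' : (I.freq e : ℝ) * (3213 * f) ≤ f * (3213 * f) := by gcongr
  have hq' : (s'.queue.length : ℝ) ≤ s.queue.length + f := by exact_mod_cast hq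
  rw [potential, potential]
  linarith

/-- The change of the potential when the element `e` ceases to be active. -/
theorem potential_erase_le (h : Consistent I f A X s) (h' : Wf I f (A.erase e) X s') (hf1 : 1 ≤ f)
    (he : e ∈ A) (hlev : s'.level = s.level)
    (helt : s'.eltLevel = s.eltLevel) (hq : s'.queue.length ≤ s.queue.length + f) :
    potential I f (A.erase e) s' ≤ potential I f A s + 138 * f := by
  have key : ∀ S, 153 * f * upPotential (I.elems (A.erase e) S) s'.eltLevel (beta f * I.cost S)
        (I.base f S) (s'.level S) + downPotential I f s' S ≤
      153 * f * upPotential (I.elems A S) s.eltLevel (beta f * I.cost S)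
        (I.base f S) (s.level S) + downPotential I f s S +
        if e ∈ I.family S then 128 else 0 := by
    intro S
    have hM := (beta_mul_cost_pos (I := I) (S := S) hf1).le
    have hup := upPotential_le_add (E := I.elems A S) (E' := I.elems (A.erase e) S)
      (v := s.eltLevel) (v' := s'.eltLevel) (l := s.level S) (b := I.base f S) hM le_rfl
      fun j _ => by
        rw [add_zero, helt]
        exact scaledDual_mono (Finset.filter_subset_filter _ (Finset.erase_subset _ _))
    have hdown : downPotential I f s' S ≤
        downPotential I f s S + 128 * if e ∈ I.family S then 1 else 0 := by
      refine downPotential_le_add (by split_ifs <;> norm_num) (congrFun hlev S) ?_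
      rw [(h.wf.data S).dual_eq, (h'.data S).dual_eq, helt, elems_erase]
      split_ifs with heS
      · have heE : e ∈ I.elems A S := mem_elems.2 ⟨he, heS⟩
        rw [← Finset.add_sum_erase _ _ heE, add_sub_cancel_right, dual, ← zpow_add₀ (by norm_num)]
        refine zpow_le_one_of_nonpos₀ (by norm_num) ?_
        have := h.level_le heE
        omega
      · rw [Finset.erase_eq_of_notMem fun hm => heS (mem_elems.1 hm).2]
        simp
    rw [hlev]
    have h₁ := mul_le_mul_of_nonneg_left hup (show (0 : ℝ) ≤ 153 * f by positivity)
    split_ifs at hdown ⊢ <;> linarith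
  have hsum := Finset.sum_le_sum fun S (_ : S ∈ Finset.univ) => key S
  rw [Finset.sum_add_distrib (g := fun S => if e ∈ I.family S then _ else _),
    sum_ite_mem_family] at hsum
  have hf' : (I.freq e : ℝ) ≤ f := by exact_mod_cast h.freq_le e he
  have hq' : (s'.queue.length : ℝ) ≤ s.queue.length + f := by exact_mod_cast hq
  rw [potential, potential]
  linarith

theorem wp_arrival (h : Consistent I f A ∅ s) (he : e ∉ A) (hf : I.freq e ≤ f) :
    wp (arrival I f e) s fun _ t s' => Consistent I f (insert e A) ∅ s' ∧ s'.queue = [] ∧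
      t + potential I f (insert e A) s' ≤ potential I f A s + 4000 * f ^ 2 := by
  have hf1 := one_le_of_freq hf
  have hnd := (I.setsOf e).nodup_toList
  have hmem : ∀ S, S ∈ (I.setsOf e).toList ↔ e ∈ I.family S := fun S => by simp [setsOf]
  have hlen : (I.setsOf e).toList.length = I.freq e := Finset.length_toList _
  rw [arrival]
  rcases hL : (I.setsOf e).toList with _ | ⟨S₀, rest⟩
  · rw [Finset.toList_eq_nil] at hL
    exact absurd hL (I.setsOf_nonempty e).ne_empty
  rw [hL] at hnd hmem hlen
  have hmem₀ : ∀ S, S ∈ rest → e ∈ I.family S := fun S hS => (hmem S).1 (by simp [hS])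
  simp only [wp_bind, wp_readLevel, wp_writeEltLevel]
  refine wp_mono (wp_foldEach (fun rest' a t' s' => t' + 2 * rest'.length = 2 * rest.length ∧
    s' = s ∧ (∀ S, e ∈ I.family S → S ∈ rest' ∨ s.level S ≤ a) ∧
    (∃ S, e ∈ I.family S ∧ s.level S = a) ∧ ∀ S ∈ rest', e ∈ I.family S) ?_ ?_) ?_
  · refine ⟨zero_add _, rfl, fun S hS => ?_, ⟨S₀, (hmem S₀).1 (by simp), rfl⟩, hmem₀⟩
    rcases List.mem_cons.1 ((hmem S).2 hS) with rfl | hS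
    exacts [.inr le_rfl, .inl hS]
  · rintro S rest' a t' s' ⟨g₁, rfl, g₃, ⟨S₁, g₄, g₅⟩, g₆⟩
    simp only [wp_bind, wp_readLevel, wp_pure, List.length_cons] at g₁ ⊢
    refine ⟨by omega, trivial, fun S' hS' => ?_, ?_, fun S' hS' => g₆ S' (by simp [hS'])⟩
    · rcases g₃ S' hS' with hm | hle
      · rcases List.mem_cons.1 hm with rfl | hm
        exacts [.inr (le_max_right _ _), .inl hm]
      · exact .inr (hle.trans (le_max_left _ _))
    · rcases max_choice a (s'.level S) with hm | hm
      · exact ⟨S₁, g₄, by rw [hm, g₅]⟩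
      · exact ⟨S, g₆ S (by simp), hm.symm⟩
  rintro l t₁ s₁ ⟨g₁, rfl, g₃, g₄, -⟩
  simp only [List.length_nil, mul_zero, add_zero, List.not_mem_nil, false_or] at g₁ g₃
  refine wp_mono (wp_insertAll h.wf he hnd hmem) ?_
  rintro _ t₂ s₂ ⟨ht₂, hwf, hlev, helt, hq⟩
  have hother : ∀ a ∈ A, s₂.eltLevel a = s₁.eltLevel a := fun a ha => by
    rw [helt, Function.update_of_ne]
    rintro rfl
    exact he ha
  have hcons : Consistent I f (insert e A) ∅ s₂ := by
    refine ⟨hwf, fun a ha => ?_, fun S => by rw [hlev]; exact h.base_le S, fun a ha => ?_⟩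
    · rw [hlev]
      rcases Finset.mem_insert.1 ha with rfl | ha
      · rw [helt, Function.update_self]
        exact (elementLevel_eq_iff.2 ⟨g₃, g₄⟩).symm
      · rw [hother a ha, h.level_eq a ha]
    · rcases Finset.mem_insert.1 ha with rfl | ha
      exacts [hf, h.freq_le a ha]
  have hpot := potential_insert_le h.wf hwf hf1 hf hlev hother (by omega)
  refine wp_mono (wp_stabilize_amortized hcons hf1) ?_
  rintro _ t₃ s₃ ⟨hcons₃, hq₃, ht₃⟩
  refine ⟨hcons₃, hq₃, ?_⟩
  have hf1' : (1 : ℝ) ≤ f := by exact_mod_cast hf1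
  have ht : ((1 + (t₁ + (1 + t₂)) : ℕ) : ℝ) ≤ 10 * f := by
    rw [List.length_cons] at hlen ht₂
    exact_mod_cast (by omega : 1 + (t₁ + (1 + t₂)) ≤ 10 * f)
  -- The total charge is 3213 f² + 10 f for the potential, 10 f direct steps and 2 for the end of
  -- the stabilization.
  push_cast at ht ⊢
  nlinarith

theorem wp_departure (h : Consistent I f A ∅ s) (he : e ∈ A) :
    wp (departure I f e) s fun _ t s' => Consistent I f (A.erase e) ∅ s' ∧ s'.queue = [] ∧
      t + potential I f (A.erase e) s' ≤ potential I f A s + 4000 * f ^ 2 := by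
  have hf := h.freq_le e he
  have hf1 := one_le_of_freq hf
  simp only [departure, wp_bind, wp_readEltLevel, wp_readNodelist]
  refine wp_mono (wp_eraseAll h.wf he) ?_
  rintro _ t₁ s₁ ⟨ht₁, hwf, hlev, helt, hq⟩
  have hcons : Consistent I f (A.erase e) ∅ s₁ := by
    refine ⟨hwf, fun a ha => ?_, fun S => by rw [hlev]; exact h.base_le S, fun a ha =>
      h.freq_le a (Finset.mem_of_mem_erase ha)⟩
    rw [hlev, helt, h.level_eq a (Finset.mem_of_mem_erase ha)]
  have hpot := potential_erase_le h hwf hf1 he hlev helt (by omega)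
  refine wp_mono (wp_stabilize_amortized hcons hf1) ?_
  rintro _ t₂ s₂ ⟨hcons₂, hq₂, ht₂⟩
  refine ⟨hcons₂, hq₂, ?_⟩
  have hf1' : (1 : ℝ) ≤ f := by exact_mod_cast hf1
  have ht : (t₁ : ℝ) ≤ 8 * f := by exact_mod_cast (by omega : t₁ ≤ 8 * f)
  push_cast
  nlinarith

/-- The amortized cost of a sequence of updates. -/
theorem wp_processAll (σ : List (Update U)) (hA : Consistent I f A ∅ s) (hq : s.queue = [])
    (hσ : LegalFrom (A : Set U) σ) (hf : ∀ e, Update.arrive e ∈ σ → I.freq e ≤ f) :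
    wp (processAll I f σ) s fun _ t s' => ∃ A' : Finset U, (A' : Set U) = σ.foldl Update.apply A ∧
      Consistent I f A' ∅ s' ∧ s'.queue = [] ∧
      t + potential I f A' s' ≤ potential I f A s + 4000 * f ^ 2 * σ.length := by
  induction σ generalizing A s with
  | nil =>
    rw [processAll, wp_pure]
    exact ⟨A, rfl, hA, hq, by simp⟩
  | cons u σ ih =>
    obtain ⟨hu, hσ⟩ := hσ
    have hf' : ∀ e, Update.arrive e ∈ σ → I.freq e ≤ f := fun e he => hf e (by simp [he])
    rw [processAll, wp_bind]
    have step : wp (process I f u) s fun _ t s' => ∃ A₁ : Finset U, (A₁ : Set U) = u.apply A ∧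
        Consistent I f A₁ ∅ s' ∧ s'.queue = [] ∧
        t + potential I f A₁ s' ≤ potential I f A s + 4000 * f ^ 2 := by
      cases u with
      | arrive e =>
        refine wp_mono (wp_arrival hA (Finset.mem_coe.not.1 hu) (hf e (by simp))) ?_
        rintro _ t s' ⟨h₁, h₂, h₃⟩
        exact ⟨insert e A, by simp [Update.apply], h₁, h₂, h₃⟩
      | depart e =>
        refine wp_mono (wp_departure hA (Finset.mem_coe.1 hu)) ?_
        rintro _ t s' ⟨h₁, h₂, h₃⟩
        exact ⟨A.erase e, by simp [Update.apply], h₁, h₂, h₃⟩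
    refine wp_mono step ?_
    rintro _ t s₁ ⟨A₁, hA₁, hcons, hq₁, ht⟩
    rw [← hA₁] at hσ
    refine wp_mono (ih hcons hq₁ hσ hf') ?_
    rintro _ t' s₂ ⟨A₂, hA₂, hcons₂, hq₂, ht'⟩
    refine ⟨A₂, by rw [hA₂, hA₁]; rfl, hcons₂, hq₂, ?_⟩
    push_cast [List.length_cons]
    linarith

theorem one_le_of_legal {u : Update U} {σ : List (Update U)} (hσ : Legal (u :: σ))
    (hf : ∀ e, Update.arrive e ∈ u :: σ → I.freq e ≤ f) : 1 ≤ f := by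
  cases u with
  | arrive e => exact one_le_of_freq (hf e (by simp))
  | depart e => exact absurd hσ.1 (Set.notMem_empty e)

/-! ### The initial memory, stability, and the cost of the solution -/

theorem consistent_emptyStore : Consistent I f ∅ ∅ (emptyStore (I.base f)) := by
  refine ⟨⟨fun S => ⟨fun k => List.nodup_nil, fun k e => ?_, ?_⟩, by simp, by simp,
    fun _ _ => rfl, fun S hS => ?_, fun S _ hu => ?_⟩, by simp, fun S => le_rfl, by simp⟩
  · simp [emptyStore, elems]
  · simp [emptyStore, elems]
  · simp [emptyStore] at hS
  · rcases hu with hu | ⟨-, hu⟩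
    · have : 0 ≤ beta f * I.cost S := mul_nonneg (by rw [beta]; positivity) (I.cost_pos S).le
      exact absurd hu (not_lt.2 this)
    · exact absurd hu (lt_irrefl _)

theorem potential_emptyStore : potential I f ∅ (emptyStore (I.base f)) = 0 := by
  have hup : ∀ S, upPotential (I.elems ∅ S) (emptyStore (I.base f) : Store U ι).eltLevel
      (beta f * I.cost S) (I.base f S) (I.base f S) = 0 := fun S => by
    refine upPotential_eq_zero le_rfl ?_
    have : 0 ≤ beta f * I.cost S := mul_nonneg (by rw [beta]; positivity) (I.cost_pos S).le
    simp only [scaledDual, elems, Finset.filter_empty, Finset.sum_empty]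
    positivity
  have hd : ∀ S, downPotential I f (emptyStore (I.base f)) S = 0 := fun S => by
    rw [downPotential, if_neg]
    exact lt_irrefl _
  simp only [potential, hd, add_zero]
  rw [Finset.sum_eq_zero fun S _ => by erw [hup S, mul_zero]]
  simp [emptyStore]

theorem solution_base : I.solution f (I.base f) = ∅ := by simp [solution]

theorem Consistent.setDual_eq (h : Consistent I f A X s) (S : ι) :
    I.setDual s.level A S = s.ySet S := by
  have hset : I.family S ∩ (A : Set U) = (I.elems A S : Finset U) := by
    ext e
    simp [mem_elems, and_comm]
  rw [setDual, (h.wf.data S).dual_eq, hset, finsum_mem_coe_finset]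
  exact Finset.sum_congr rfl fun e he => by rw [h.level_eq e (mem_elems.1 he).1]

theorem Consistent.stable (h : Consistent I f A ∅ s) (hq : s.queue = []) (S : ι) :
    I.Stable f s.level A S := by
  have hns : ¬ Unstable I f s S := fun hu => by
    have := h.wf.queue.mem_queue S (h.wf.queue.inQueue S (Set.notMem_empty _) hu)
    simp [hq] at this
  rw [Unstable, not_or, not_and, not_lt, not_lt] at hns
  rw [Stable, h.setDual_eq]
  refine ⟨h.base_le S, fun hb => ⟨?_, hns.1⟩, fun _ => hns.1⟩
  by_contra hlt
  exact absurd hb (not_lt.2 (hns.2 (not_le.1 hlt)))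

/-- A set attaining the level of `e` works: at its base level, `e` alone would give 1 ≤ 2^b y(S) ≤
2^b M ≤ 1/2. -/
theorem Consistent.covers (h : Consistent I f A ∅ s) (hst : ∀ S, I.Stable f s.level A S) :
    I.Covers (I.solution f s.level) A := by
  intro e he
  have heA := Finset.mem_coe.1 he
  have hf1 := one_le_of_freq (h.freq_le e heA)
  obtain ⟨-, S, hS, hlS⟩ := elementLevel_eq_iff.1 (h.level_eq e heA).symm
  refine ⟨S, ?_, hS⟩
  rw [solution, Finset.mem_filter]
  refine ⟨Finset.mem_univ _, lt_of_le_of_ne (h.base_le S) fun hb => ?_⟩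
  have h₁ := (hst S).2.2 hb.symm
  have hM := beta_mul_cost_pos (I := I) (S := S) hf1
  have h₂ : dual (I.base f S) ≤ s.ySet S := by
    rw [(h.wf.data S).dual_eq, hb, hlS]
    exact Finset.single_le_sum (f := fun e => dual (s.eltLevel e)) (fun _ _ => (dual_pos _).le)
      (mem_elems.2 ⟨heA, hS⟩)
  rw [h.setDual_eq] at h₁
  have h₃ := zpow_mul_dual (I.base f S)
  have h₄ := mul_le_mul_of_nonneg_left (h₂.trans h₁)
    (show (0 : ℝ) ≤ 2 ^ I.base f S by positivity)
  have h₅ := base_mul_le_half (I := I) (S := S) hf1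
  linarith

/-- Weak duality with slack: a factor β for c_S ≤ β y(S), a factor `f` for exchanging sets and
elements, and a factor β because the y(e) are β times a feasible fractional packing. -/
theorem Consistent.totalCost_le (h : Consistent I f A ∅ s) (hf1 : 1 ≤ f)
    (hst : ∀ S, I.Stable f s.level A S) {X : Finset ι} (hX : I.Covers X A) :
    I.totalCost (I.solution f s.level) ≤ 1024 * (f : ℝ) ^ 3 * I.totalCost X := by
  have hb := beta_pos hf1
  set y := fun e => dual (s.eltLevel e) with hy
  have hy0 : ∀ e, 0 ≤ y e := fun e => (dual_pos _).le
  have hyS : ∀ S, s.ySet S = ∑ e ∈ A, if e ∈ I.family S then y e else 0 := fun S => by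
    rw [(h.wf.data S).dual_eq, elems, Finset.sum_filter]
  have h₁ : I.totalCost (I.solution f s.level) ≤ beta f * ∑ S, s.ySet S := by
    rw [totalCost, Finset.mul_sum]
    refine (Finset.sum_le_sum fun S hS => ?_).trans (Finset.sum_le_sum_of_subset_of_nonneg
      (Finset.subset_univ _) fun S _ _ => mul_nonneg hb.le ?_)
    · have h₂ := ((hst S).2.1 (Finset.mem_filter.1 hS).2).1
      rw [h.setDual_eq, div_le_iff₀ hb] at h₂
      linarith
    · rw [(h.wf.data S).dual_eq]
      exact Finset.sum_nonneg fun e _ => hy0 e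
  have h₂ : ∑ S, s.ySet S ≤ f * ∑ e ∈ A, y e := by
    simp only [hyS]
    rw [Finset.sum_comm, Finset.mul_sum]
    refine Finset.sum_le_sum fun e he => ?_
    rw [sum_ite_mem_family]
    have : (I.freq e : ℝ) ≤ f := by exact_mod_cast h.freq_le e he
    exact mul_le_mul_of_nonneg_right this (hy0 e)
  have h₃ : ∑ e ∈ A, y e ≤ beta f * I.totalCost X := by
    calc ∑ e ∈ A, y e ≤ ∑ e ∈ A, ∑ S ∈ X, if e ∈ I.family S then y e else 0 := by
          refine Finset.sum_le_sum fun e he => ?_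
          obtain ⟨S, hS, heS⟩ := hX e (Finset.mem_coe.2 he)
          have := Finset.single_le_sum (f := fun S => if e ∈ I.family S then y e else 0)
            (fun S _ => by split_ifs; exacts [hy0 e, le_rfl]) hS
          simpa [heS] using this
      _ = ∑ S ∈ X, s.ySet S := by rw [Finset.sum_comm]; simp only [hyS]
      _ ≤ ∑ S ∈ X, beta f * I.cost S := by
          refine Finset.sum_le_sum fun S _ => ?_
          rw [← h.setDual_eq]
          rcases (h.base_le S).lt_or_eq with hlt | heq
          · exact ((hst S).2.1 hlt).2
          · exact (hst S).2.2 heq.symm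
      _ = _ := by rw [totalCost, Finset.mul_sum]
  calc _ ≤ beta f * (f * (beta f * I.totalCost X)) := by
        refine h₁.trans ?_
        gcongr
        exact h₂.trans (by gcongr)
    _ = _ := by rw [beta]; ring

end

end

end DynSetCover

/-! ### The main theorem, assembled from the invariants, the duality bound and the potential. -/

theorem mainTheorem1 :
    ∃ C : ℕ, ∀ (U ι : Type) [Fintype ι] (I : DynSetCover.SetSystem U ι) (f : ℕ)
      (σ : List (DynSetCover.Update U)),
      DynSetCover.Legal σ →
      (∀ e : U, DynSetCover.Update.arrive e ∈ σ → I.freq e ≤ f) →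
      ∃ r ∈ DynSetCover.run I f σ,
        -- the recorded levels and dual values are those induced by the levels of the sets
        (∀ e ∈ DynSetCover.active σ, r.store.eltLevel e = I.elementLevel r.store.level e) ∧
        (∀ S : ι, r.store.ySet S = I.setDual r.store.level (DynSetCover.active σ) S) ∧
        -- every set is stable
        (∀ S : ι, I.Stable f r.store.level (DynSetCover.active σ) S) ∧
        -- the solution is feasible
        I.Covers (I.solution f r.store.level) (DynSetCover.active σ) ∧
        -- its cost is at most `C f ^ 3` times the cost of every (so of an optimal) cover
        (∀ X : Finset ι, I.Covers X (DynSetCover.active σ) →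
          I.totalCost (I.solution f r.store.level) ≤ C * (f : ℝ) ^ 3 * I.totalCost X) ∧
        -- the number of steps is at most `C f ^ 2` per update
        r.time ≤ C * f ^ 2 * σ.length := by
  refine ⟨4000, fun U ι _ I f σ hσ hf => ?_⟩
  obtain ⟨r, hr, A, hA, hcons, hq, ht⟩ := DynSetCover.wp_processAll (I := I) (f := f) (A := ∅) σ
    DynSetCover.consistent_emptyStore rfl (by rw [Finset.coe_empty]; exact hσ) hf
  have hact : DynSetCover.active σ = A := by rw [hA, Finset.coe_empty]; rfl
  rw [DynSetCover.potential_emptyStore, zero_add] at ht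
  have hst := hcons.stable hq
  refine ⟨r, hr, ?_, ?_, ?_, ?_, ?_, ?_⟩ <;> rw [hact] at *
  · exact fun e he => hcons.level_eq e (Finset.mem_coe.1 he)
  · exact fun S => (hcons.setDual_eq S).symm
  · exact hst
  · exact hcons.covers hst
  · intro X hX
    have hX0 : 0 ≤ I.totalCost X := Finset.sum_nonneg fun S _ => (I.cost_pos S).le
    -- Without updates `f` may be 0 and duality is unavailable, but then all sets are at their base
    -- levels and the solution is empty. Otherwise the first update is an arrival, which forces `f`
    -- to be at least 1.
    cases σ with
    | nil =>
      obtain rfl := Part.mem_some_iff.1 hr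
      have : I.totalCost (I.solution f (I.base f)) = 0 := by
        rw [DynSetCover.solution_base, DynSetCover.SetSystem.totalCost, Finset.sum_empty]
      exact this.trans_le (by positivity)
    | cons u σ =>
      refine (hcons.totalCost_le (DynSetCover.one_le_of_legal hσ hf) hst hX).trans ?_
      gcongr
      norm_num
  · have h0 := DynSetCover.potential_nonneg (I := I) (f := f) (A := A) (s := r.store)
    have : (r.time : ℝ) ≤ ((4000 * f ^ 2 * σ.length : ℕ) : ℝ) := by
      push_cast
      linarith
    exact_mod_cast this
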